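/- **Definitions.** A *Leja sequence initiated at $1$* is a sequence $E=(e_j)_{j\ge 0}$ in the closed unit disc $\mathcal U=\{z\in\mathbb C:|z|\le 1\}$ with $e_0=1$ and, for every $k\ge 1$, $|e_k-e_{k-1}|\cdots|e_k-e_0|=\max_{z\in\mathcal U}|z-e_{k-1}|\cdots|z-e_0|$. The associated *$\Re$-Leja sequence* $R=(r_k)_{k\ge 0}$ in $[-1,1]$ is the projection of $E$ onto $[-1,1]$ without repetition: $r_k=\Re(e_{J(k)})$, where $J(0)=0$ and $J(k)=\min\{j>J(k-1):\Re(e_j)\notin\{r_0,\dots,r_{k-1}\}\}$ for $k\ge 1$. An $\Re$-Leja sequence is a sequence obtained in this way from some Leja sequence initiated at $1$. For finitely many distinct points of a compact set $X$, the *Lebesgue constant* is the norm of the operator of Lagrange interpolation at these points on $C(X)$ with the maximum norm; equivalently, it is $\max_{z\in X}\sum_i|l_i(z)|$, where the $l_i$ are the Lagrange polynomials of the points. Let $\mathbb L_{R_k}$ be the Lebesgue constant of $R_k=(r_0,\dots,r_{k-1})$ on $X=[-1,1]$, and $\mathbb L_{2^p}$ that of the set of $2^p$-th roots of unity on $X=\mathcal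 U$. For an integer $l\ge1$ let $\sigma_1(l)$ be the number of ones in the binary expansion of $l$ and $p(l)$ the largest integer $p$ such that $2^p$ divides $l$. **Theorem.** Let $R$ be an $\Re$-Leja sequence. 1. For all integers $n\ge 0$ and $k$ with $2^n<k-1<2^{n+1}$, with $l=k-(2^n+1)$ (so that $0<l<2^n$), $$\mathbb L_{R_k}\le 6\sqrt5\;2^{\,n+\sigma_1(l)-p(l)}\;\mathbb L_{2^{p(l)}}.$$ 2. Here $\mathbb L_{1}=1$, $\mathbb L_{2}=\sqrt2$, and $\mathbb L_{2^p}\le\frac2\pi\left(\log(2^p)+\frac94\right)$ for every $p\ge 2$. 3. In particular the bound is logarithmic for many $k$: for all integers $1\le m\le n$ and $1\le k'<2^m$, $$\mathbb L_{R_k}\le 6\sqrt5\;2^{2m}\;\frac2\pi\left(\log(2^n)+\frac94\right)\qquad\text{for } k=2^n+1+2^{n-m}k'.$$ -/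

import Mathlib

namespace RLeja

noncomputable section

/-- The closed unit disc of the complex plane. -/
abbrev Disc : Set ℂ := Metric.closedBall (0 : ℂ) 1

/-- The interval `[-1, 1]`. -/
abbrev Interval : Set ℝ := Set.Icc (-1 : ℝ) 1

section Interpolation

variable {𝕜 : Type*} [RCLike 𝕜] {X : Set 𝕜} {ι : Type*} [Fintype ι] [DecidableEq ι]

/-- The Lagrange polynomial `l_i` of the (mutually distinct) nodes `v`. -/
def lagrangePoly (v : ι → X) (i : ι) : Polynomial 𝕜 :=
  Lagrange.basis Finset.univ (fun j => (v j : 𝕜)) i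

/-- The Lebesgue function `λ(z) = ∑ |l_i(z)|`, for `z ∈ X`. -/
def lebesgueFunction (v : ι → X) (z : X) : ℝ :=
  ∑ i, ‖(lagrangePoly v i).eval (z : 𝕜)‖

/-- The Lagrange interpolation operator `f ↦ ∑ f(v_i) l_i` at the nodes `v`,
as an operator on `C(X)`. -/
def interpolation [CompactSpace X] (v : ι → X) : C(X, 𝕜) →L[𝕜] C(X, 𝕜) :=
  ∑ i, (ContinuousMap.evalCLM 𝕜 (v i)).smulRight ((lagrangePoly v i).toContinuousMapOn X)

/-- The Lebesgue constant of the nodes `v`: the norm of the interpolation operator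
for the maximum norm on `C(X)`. -/
def lebesgueConstant [CompactSpace X] (v : ι → X) : ℝ := ‖interpolation v‖

theorem interpolation_apply [CompactSpace X] (v : ι → X) (f : C(X, 𝕜)) (z : X) :
    interpolation v f z = ∑ i, f (v i) * (lagrangePoly v i).eval (z : 𝕜) := by
  simp [interpolation, ContinuousMap.sum_apply]

/-- The Lebesgue constant is the maximum of the Lebesgue function. -/
theorem isGreatest_lebesgueConstant [CompactSpace X] [Nonempty X] (v : ι → X)
    (hv : Function.Injective v) :
    IsGreatest (Set.range (lebesgueFunction v)) (lebesgueConstant v) := by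
  have hcont : Continuous (lebesgueFunction v) := by
    unfold lebesgueFunction
    exact continuous_finsetSum _ fun i _ =>
      ((lagrangePoly v i).continuous.comp continuous_subtype_val).norm
  have hle : ∀ x, lebesgueFunction v x ≤ lebesgueConstant v := by
    intro x
    let c : ι → 𝕜 := fun i => ((lagrangePoly v i).eval (x : 𝕜))
    let u : ι → 𝕜 := fun i => if c i = 0 then 0 else (‖c i‖ : 𝕜) / c i
    have hu : ∀ i, ‖u i‖ ≤ 1 := by
      intro i
      by_cases h : c i = 0
      · simp [u, h]
      · simp [u, h]
    have huc : ∀ i, u i * c i = (‖c i‖ : 𝕜) := by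
      intro i
      by_cases h : c i = 0
      · simp [u, h]
      · simp [u, h]
    let s : Set X := Set.range v
    have hfin : s.Finite := Set.finite_range v
    have : Finite s := hfin
    let e : ι ≃ s := Equiv.ofInjective v hv
    let g : C(s, 𝕜) := ⟨fun y => u (e.symm y), continuous_of_discreteTopology⟩
    have := Metric.instTietzeExtensionClosedBall 𝕜 (0 : 𝕜) (one_pos : (0 : ℝ) < 1)
    obtain ⟨f, hf, hfg⟩ := g.exists_forall_mem_restrict_eq (t := Metric.closedBall (0 : 𝕜) 1)
      hfin.isClosed (fun y => by simpa [g] using hu (e.symm y))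
    have hfv : ∀ i, f (v i) = u i := by
      intro i
      have h := congrArg (fun q => q (e i)) hfg
      have h2 : f (v i) = u (e.symm (e i)) := h
      rwa [e.symm_apply_apply] at h2
    have hf1 : ‖f‖ ≤ 1 := (ContinuousMap.norm_le _ zero_le_one).2 fun y => by simpa using hf y
    have h1 : interpolation v f x = ((lebesgueFunction v x : ℝ) : 𝕜) := by
      rw [interpolation_apply]
      simp only [hfv, lebesgueFunction, RCLike.ofReal_sum]
      exact Finset.sum_congr rfl fun i _ => huc i
    have h0 : 0 ≤ lebesgueFunction v x := Finset.sum_nonneg fun i _ => norm_nonneg _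
    calc lebesgueFunction v x = ‖interpolation v f x‖ := by
          rw [h1, RCLike.norm_ofReal, abs_of_nonneg h0]
      _ ≤ ‖interpolation v f‖ := ContinuousMap.norm_coe_le_norm _ x
      _ ≤ ‖interpolation v‖ * ‖f‖ := (interpolation v).le_opNorm f
      _ ≤ ‖interpolation v‖ := mul_le_of_le_one_right (norm_nonneg _) hf1
  obtain ⟨x, -, hx⟩ := isCompact_univ.exists_isMaxOn Set.univ_nonempty hcont.continuousOn
  have hx' : ∀ y, lebesgueFunction v y ≤ lebesgueFunction v x := fun y => hx (Set.mem_univ y)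
  have h0 : 0 ≤ lebesgueFunction v x := Finset.sum_nonneg fun i _ => norm_nonneg _
  refine ⟨⟨x, le_antisymm (hle x) ?_⟩, ?_⟩
  · refine ContinuousLinearMap.opNorm_le_bound _ h0 fun f => ?_
    refine (ContinuousMap.norm_le _ (mul_nonneg h0 (norm_nonneg _))).2 fun y => ?_
    rw [interpolation_apply]
    refine (norm_sum_le _ _).trans ?_
    refine le_trans ?_ (mul_le_mul_of_nonneg_right (hx' y) (norm_nonneg f))
    rw [lebesgueFunction, Finset.sum_mul]
    refine Finset.sum_le_sum fun i _ => ?_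
    rw [norm_mul, mul_comm]
    exact mul_le_mul_of_nonneg_left (f.norm_coe_le_norm _) (norm_nonneg _)
  · rintro _ ⟨y, rfl⟩
    exact hle y

end Interpolation

/-- The section `Z_k = (z_0, …, z_{k-1})` of a sequence. -/
def initialSection {α : Type*} (Z : ℕ → α) (k : ℕ) : Fin k → α := fun i => Z i

/-- `E` is a Leja sequence on the closed unit disc initiated at `1`: `e_0 = 1` and, for `k ≥ 1`,
`e_k` is one of the points of the disc that maximize `z ↦ |z - e_{k-1}| ⋯ |z - e_0|`. -/
def IsLejaFromOne (E : ℕ → Disc) : Prop :=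
  (E 0 : ℂ) = 1 ∧
    ∀ k, 1 ≤ k → ∀ z : Disc,
      ∏ j ∈ Finset.range k, ‖(z : ℂ) - E j‖ ≤ ∏ j ∈ Finset.range k, ‖(E k : ℂ) - E j‖

/-- `R` is the `ℜ`-Leja sequence associated with `E`: its elements are the real parts of the
elements of `E`, taken in order and without repetition. Here `J k` is the index of the element
of `E` that is projected to `r_k`; it is the least `j > J (k-1)` with `ℜ (e_j)` not among
`r_0, …, r_{k-1}`. -/
def IsProjectionOf (R : ℕ → Interval) (E : ℕ → Disc) : Prop :=
  ∃ J : ℕ → ℕ, J 0 = 0 ∧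
    (∀ k, IsLeast {j | J k < j ∧ ∀ i ≤ k, (E j : ℂ).re ≠ R i} (J (k + 1))) ∧
    ∀ k, (R k : ℝ) = (E (J k) : ℂ).re

/-- `R` is an `ℜ`-Leja sequence: the projection without repetition onto `[-1, 1]` of some
Leja sequence on the disc initiated at `1`. -/
def IsRLeja (R : ℕ → Interval) : Prop :=
  ∃ E : ℕ → Disc, IsLejaFromOne E ∧ IsProjectionOf R E

/-- The `N`-th roots of unity `exp (2 π i j / N)`, `0 ≤ j < N`, as points of the disc. -/
def unityRoots (N : ℕ) (j : Fin N) : Disc :=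
  ⟨Complex.exp (((2 * Real.pi * j / N : ℝ) : ℂ) * Complex.I), by
    rw [mem_closedBall_zero_iff, Complex.norm_exp_ofReal_mul_I]⟩

/-- `𝕃_{2^p}`: the Lebesgue constant, on the disc, of the set of `2^p`-th roots of unity. -/
def lebesgueRoots (p : ℕ) : ℝ := lebesgueConstant (unityRoots (2 ^ p))

/-- `𝕃_{R_k}`: the Lebesgue constant, on `[-1, 1]`, of the section `R_k = (r_0, …, r_{k-1})`. -/
def lebesgueSection (R : ℕ → Interval) (k : ℕ) : ℝ := lebesgueConstant (initialSection R k)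

/-- The number of ones in the binary expansion of `l`. -/
def sigmaOne (l : ℕ) : ℕ := (Nat.digits 2 l).count 1

/-- The largest `p` such that `2^p` divides `l`, for `l ≥ 1`. -/
def twoVal (l : ℕ) : ℕ := padicValNat 2 l

end

end RLeja

namespace RLeja

open Finset ComplexConjugate

/-! ### Binary digit sums -/

/-! A Leja sequence `E` is self-similar: `E (2j+1) = -E (2j)`, and the squares of the even terms
again form a Leja sequence (`IsLeja.odd`, `IsLeja.sqSeq`). Hence the first `2^p` terms are the roots
of unity, every later aligned block of length `2^p` is a coset of them, and most quantities below
obey a recursion along the binary digits of the number of nodes.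

With `k = 2^n + 1 + l`, the nodes `R_k` are the real parts of the first `2^(n+1) + l` terms of `E`.
For `x = Re z` with `|z| = 1`, one has `2|x - Re b| = |z - b||z - conj b|`. Let `B` be the monic
polynomial vanishing at the last `l` terms. This factorization bounds the Lebesgue function at `x`
by the sums, at `z` and at `conj z`, of `|l_j| · |B(conj z)| / |B(conj e_j)|`, where the `l_j` are
the complex Lagrange polynomials (`sum_lagSet_reSection_le_weightedLag`).

The numerator is at most `2^σ₁(l)` (`norm_block_le`). For odd `l` the rest is estimated by
Cauchy-Schwarz: `∑ |l_j|²` is at most `6 · 2^(σ₁(l)+1)` (`quad_le`), and the sum of the `|B(conj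
e_j)|⁻²` is at most `5/4 · 2^n · 2^σ₁(2^n - l)`, from an exact block formula
(`sum_inv_norm_block_sq`). As `σ₁(l) + σ₁(2^n - l) = n + 1`, the powers of `2^σ₁(l)` cancel and a
bound `3√5 · 2^n` remains; the two points `z`, `conj z` double it. A factor `2^p` of `l` is removed
by the map `z ↦ z^(2^p)`, at the price of one factor `𝕃_{2^p}` (`sum_lagN_mul_le`).

For the constants `𝕃_{2^p}`, the squares of the Lagrange moduli sum to `1` on the circle, so the two
nodes adjacent to `z` contribute at most `√2`; the others are compared with the integral of `1 /
sin`. -/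

theorem sigmaOne_zero : sigmaOne 0 = 0 := by simp [sigmaOne]

theorem sigmaOne_two_mul (l : ℕ) : sigmaOne (2 * l) = sigmaOne l := by
  rcases Nat.eq_zero_or_pos l with rfl | h
  · simp
  · have h2 := Nat.digits_add_two_add_one 0 (2 * l - 1)
    rw [show 2 * l - 1 + 1 = 2 * l by omega] at h2
    simp only [zero_add] at h2
    rw [sigmaOne, h2, sigmaOne, Nat.mul_mod_right, Nat.mul_div_cancel_left _ (by norm_num : 0 < 2)]
    simp

theorem sigmaOne_two_mul_add_one (l : ℕ) : sigmaOne (2 * l + 1) = sigmaOne l + 1 := by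
  have h2 := Nat.digits_add_two_add_one 0 (2 * l)
  simp only [zero_add] at h2
  rw [sigmaOne, h2, sigmaOne, show (2 * l + 1) % 2 = 1 by omega, show (2 * l + 1) / 2 = l by omega]
  simp

theorem sigmaOne_one : sigmaOne 1 = 1 := by
  simpa [sigmaOne_zero] using sigmaOne_two_mul_add_one 0

theorem sigmaOne_two_pow_mul (p l : ℕ) : sigmaOne (2 ^ p * l) = sigmaOne l := by
  induction p with
  | zero => simp
  | succ p ih => rw [pow_succ', mul_assoc, sigmaOne_two_mul, ih]

/-- `m'` is the bitwise complement of `m` among `b` bits. -/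
theorem sigmaOne_add_sigmaOne_compl (b m m' : ℕ) (h : m + m' + 1 = 2 ^ b) :
    sigmaOne m + sigmaOne m' = b := by
  induction b generalizing m m' with
  | zero =>
    obtain rfl : m = 0 := by simp at h; omega
    obtain rfl : m' = 0 := by simp at h; omega
    simp [sigmaOne_zero]
  | succ b ih =>
    rw [pow_succ] at h
    rcases Nat.even_or_odd' m with ⟨u, rfl | rfl⟩ <;>
      rcases Nat.even_or_odd' m' with ⟨v, rfl | rfl⟩
    · omega
    · have := ih u v (by omega)
      rw [sigmaOne_two_mul, sigmaOne_two_mul_add_one]; omega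
    · have := ih u v (by omega)
      rw [sigmaOne_two_mul, sigmaOne_two_mul_add_one]; omega
    · omega

theorem sigmaOne_le (b m : ℕ) (h : m < 2 ^ b) : sigmaOne m ≤ b := by
  have := sigmaOne_add_sigmaOne_compl b m (2 ^ b - 1 - m) (by omega)
  omega

/-- For odd `l` the lowest bit is one in both numbers, and the remaining `a - 1` bits are
complementary. -/
theorem sigmaOne_two_pow_sub (a l : ℕ) (hl : Odd l) (h : l < 2 ^ a) :
    sigmaOne (2 ^ a - l) + sigmaOne l = a + 1 := by
  obtain ⟨u, rfl⟩ := hl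
  cases a with
  | zero => simp at h
  | succ a =>
    rw [pow_succ] at h ⊢
    have := sigmaOne_add_sigmaOne_compl a u (2 ^ a - 1 - u) (by omega)
    rw [show 2 ^ a * 2 - (2 * u + 1) = 2 * (2 ^ a - 1 - u) + 1 by omega,
      sigmaOne_two_mul_add_one, sigmaOne_two_mul_add_one]
    omega

theorem sigmaOne_two_pow_add (a l : ℕ) (h : l < 2 ^ a) :
    sigmaOne (2 ^ a + l) = sigmaOne l + 1 := by
  induction a generalizing l with
  | zero =>
    obtain rfl : l = 0 := by simpa using h
    simp [sigmaOne_zero, sigmaOne_one]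
  | succ a ih =>
    rw [pow_succ] at h ⊢
    rcases Nat.even_or_odd' l with ⟨u, rfl | rfl⟩
    · rw [show 2 ^ a * 2 + 2 * u = 2 * (2 ^ a + u) by ring, sigmaOne_two_mul, sigmaOne_two_mul,
        ih u (by omega)]
    · rw [show 2 ^ a * 2 + (2 * u + 1) = 2 * (2 ^ a + u) + 1 by ring, sigmaOne_two_mul_add_one,
        sigmaOne_two_mul_add_one, ih u (by omega)]

/-! ### Pairing of consecutive indices -/

theorem prod_range_two_mul {M : Type*} [CommMonoid M] (f : ℕ → M) (k : ℕ) :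
    ∏ i ∈ range (2 * k), f i = ∏ i ∈ range k, f (2 * i) * f (2 * i + 1) := by
  induction k with
  | zero => simp
  | succ k ih =>
    rw [show 2 * (k + 1) = 2 * k + 1 + 1 by ring, prod_range_succ, prod_range_succ, ih,
      prod_range_succ, mul_assoc]

theorem sum_range_two_mul {M : Type*} [AddCommMonoid M] (f : ℕ → M) (k : ℕ) :
    ∑ i ∈ range (2 * k), f i = ∑ i ∈ range k, (f (2 * i) + f (2 * i + 1)) := by
  induction k with
  | zero => simp
  | succ k ih =>
    rw [show 2 * (k + 1) = 2 * k + 1 + 1 by ring, sum_range_succ, sum_range_succ, ih,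
      sum_range_succ, add_assoc]

/-! ### Leja sequences -/

/-- Leja sequences on the unit disc initiated at `1`, as sequences of complex numbers. -/
structure IsLeja (E : ℕ → ℂ) : Prop where
  zero : E 0 = 1
  norm_le : ∀ j, ‖E j‖ ≤ 1
  le : ∀ k (z : ℂ), ‖z‖ ≤ 1 → ∏ j ∈ range k, ‖z - E j‖ ≤ ∏ j ∈ range k, ‖E k - E j‖

/-- The squares of the elements of even index. -/
def sqSeq (E : ℕ → ℂ) : ℕ → ℂ := fun j => E (2 * j) ^ 2

theorem exists_norm_le_one_ne (E : ℕ → ℂ) (k : ℕ) : ∃ z : ℂ, ‖z‖ ≤ 1 ∧ ∀ j < k, z ≠ E j := by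
  have hinf : (Metric.closedBall (0 : ℂ) 1).Infinite := by
    refine Set.infinite_of_injective_forall_mem (f := fun n : ℕ => (1 / ((n : ℂ) + 1))) ?_ ?_
    · intro a b h
      simpa using h
    · intro n
      rw [mem_closedBall_zero_iff, norm_div, norm_one, ← Nat.cast_succ, Complex.norm_natCast]
      exact div_le_one_of_le₀ (by exact_mod_cast Nat.succ_pos n) (by positivity)
  obtain ⟨z, hz, hz'⟩ := hinf.exists_notMem_finset ((range k).image E)
  refine ⟨z, by simpa using hz, fun j hj h => hz' ?_⟩
  exact mem_image.2 ⟨j, mem_range.2 hj, h.symm⟩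

namespace IsLeja

variable {E : ℕ → ℂ}

theorem prod_pos (h : IsLeja E) (k : ℕ) : 0 < ∏ j ∈ range k, ‖E k - E j‖ := by
  obtain ⟨z, hz, hne⟩ := exists_norm_le_one_ne E k
  refine lt_of_lt_of_le (Finset.prod_pos fun j hj => ?_) (h.le k z hz)
  exact norm_pos_iff.2 (sub_ne_zero.2 (hne j (mem_range.1 hj)))

theorem ne_of_lt (h : IsLeja E) {i j : ℕ} (hij : i < j) : E j ≠ E i := by
  intro he
  have := (h.prod_pos j).ne'
  exact this (prod_eq_zero (mem_range.2 hij) (by simp [he]))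

theorem injective (h : IsLeja E) : Function.Injective E := by
  intro i j hij
  rcases lt_trichotomy i j with h1 | h1 | h1
  · exact absurd hij.symm (h.ne_of_lt h1)
  · exact h1
  · exact absurd hij (h.ne_of_lt h1)

/-- By the maximum principle an interior maximum would make the nodal polynomial constant in modulus
on the disc, although it vanishes at `E 0 = 1`. -/
theorem norm_eq (h : IsLeja E) (k : ℕ) : ‖E k‖ = 1 := by
  rcases Nat.eq_zero_or_pos k with rfl | hk
  · simp [h.zero]
  refine le_antisymm (h.norm_le k) (not_lt.1 fun hlt => ?_)
  have hd : Differentiable ℂ fun z => ∏ j ∈ range k, (z - E j) := by fun_prop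
  have hE := Complex.eqOn_closure_of_isPreconnected_of_isMaxOn_norm (U := Metric.ball (0 : ℂ) 1)
    (c := E k) (convex_ball (0 : ℂ) 1).isPreconnected Metric.isOpen_ball hd.diffContOnCl
    (by simpa using hlt) (fun z hz => by
      simpa [norm_prod] using h.le k z (by simpa using (mem_ball_zero_iff.1 hz).le))
  have h1 : (1 : ℂ) ∈ closure (Metric.ball (0 : ℂ) 1) := by
    rw [closure_ball _ one_ne_zero]; simp
  have h2 := hE h1
  simp only [Function.const_apply] at h2
  rw [prod_eq_zero (mem_range.2 hk) (by simp [h.zero])] at h2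
  have h3 := h.prod_pos k
  rw [← norm_prod, ← h2] at h3
  simp at h3

theorem ne_zero (h : IsLeja E) (k : ℕ) : E k ≠ 0 := by
  rw [← norm_pos_iff, h.norm_eq]; exact one_pos

/-- The nodal product of the first `2j` terms is a function of `z ^ 2`, so `-E (2j)` maximizes it as
`E (2j)` does, and it is also at the largest possible distance `2` from `E (2j)`. The maximizer `E
(2j+1)` must then attain this distance too, which the parallelogram law allows only at the antipode.
-/
theorem odd (h : IsLeja E) (j : ℕ) : E (2 * j + 1) = -E (2 * j) := by
  induction j using Nat.strong_induction_on with
  | _ j ih =>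
    have hA : ∀ z, ∏ i ∈ range (2 * j), ‖z - E i‖ = ∏ i ∈ range j, ‖z ^ 2 - E (2 * i) ^ 2‖ := by
      intro z
      rw [prod_range_two_mul]
      refine prod_congr rfl fun i hi => ?_
      rw [ih i (mem_range.1 hi), ← norm_mul]
      congr 1; ring
    have h1 := h.le (2 * j + 1) (-E (2 * j)) (by simpa using h.norm_le (2 * j))
    rw [prod_range_succ, prod_range_succ, hA, neg_sq, ← hA] at h1
    have h2 := h.le (2 * j) (E (2 * j + 1)) (h.norm_le _)
    have hp := h.prod_pos (2 * j)
    have h3 := h1.trans (mul_le_mul_of_nonneg_right h2 (norm_nonneg _))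
    have h4 := le_of_mul_le_mul_left h3 hp
    have h5 : ‖-E (2 * j) - E (2 * j)‖ = 2 := by
      rw [show -E (2 * j) - E (2 * j) = -(2 * E (2 * j)) by ring, norm_neg, norm_mul, h.norm_eq]
      simp
    have h6 := parallelogram_law_with_norm ℝ (E (2 * j + 1)) (E (2 * j))
    rw [h.norm_eq, h.norm_eq] at h6
    have h7 : ‖E (2 * j + 1) + E (2 * j)‖ = 0 := by
      have := norm_nonneg (E (2 * j + 1) + E (2 * j))
      nlinarith
    exact eq_neg_of_add_eq_zero_left (norm_eq_zero.1 h7)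

theorem prod_two_mul (h : IsLeja E) (j : ℕ) (z : ℂ) :
    ∏ i ∈ range (2 * j), ‖z - E i‖ = ∏ i ∈ range j, ‖z ^ 2 - sqSeq E i‖ := by
  rw [prod_range_two_mul]
  refine prod_congr rfl fun i _ => ?_
  rw [h.odd i, ← norm_mul, sqSeq]
  congr 1; ring

theorem sqSeq (h : IsLeja E) : IsLeja (sqSeq E) where
  zero := by simp [RLeja.sqSeq, h.zero]
  norm_le j := by simp [RLeja.sqSeq, h.norm_eq]
  le k z hz := by
    obtain ⟨y, rfl⟩ := IsAlgClosed.exists_pow_nat_eq z two_pos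
    rw [norm_pow] at hz
    have := h.le (2 * k) y (by
      have := norm_nonneg y
      nlinarith)
    rwa [h.prod_two_mul, h.prod_two_mul] at this

theorem iterate_sqSeq (h : IsLeja E) (a : ℕ) : IsLeja (RLeja.sqSeq^[a] E) := by
  induction a generalizing E with
  | zero => exact h
  | succ a ih => exact ih h.sqSeq

theorem sq_eq (h : IsLeja E) (i : ℕ) : E i ^ 2 = RLeja.sqSeq E (i / 2) := by
  rcases Nat.even_or_odd' i with ⟨u, rfl | rfl⟩
  · simp [RLeja.sqSeq]
  · rw [h.odd, RLeja.sqSeq, show (2 * u + 1) / 2 = u by omega, neg_sq]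

theorem pow_eq (h : IsLeja E) (a i : ℕ) : E i ^ 2 ^ a = (RLeja.sqSeq^[a] E) (i / 2 ^ a) := by
  induction a generalizing E i with
  | zero => simp
  | succ a ih =>
    rw [pow_succ', pow_mul, h.sq_eq, ih h.sqSeq, Nat.div_div_eq_div_mul, Function.iterate_succ_apply]

theorem pow_eq' (h : IsLeja E) (a c i : ℕ) (hi : i < 2 ^ a) :
    E (c * 2 ^ a + i) ^ 2 ^ a = (RLeja.sqSeq^[a] E) c := by
  rw [h.pow_eq, Nat.add_comm, Nat.add_mul_div_right _ _ (by positivity), Nat.div_eq_of_lt hi,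
    zero_add]

theorem one_eq (h : IsLeja E) : E 1 = -1 := by
  simpa [h.zero] using h.odd 0

theorem two_sq (h : IsLeja E) : E 2 ^ 2 = -1 := by
  have := h.sq_eq 2
  rw [this]; exact h.sqSeq.one_eq

end IsLeja

/-! ### Nodal products over blocks of indices -/

/-- The monic polynomial vanishing at `E o, …, E (o + l - 1)`, evaluated at `z`. -/
def block (E : ℕ → ℂ) (o l : ℕ) (z : ℂ) : ℂ := ∏ i ∈ range l, (z - E (o + i))

variable {E : ℕ → ℂ}

theorem block_succ (E : ℕ → ℂ) (o l : ℕ) (z : ℂ) :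
    block E o (l + 1) z = block E o l z * (z - E (o + l)) := prod_range_succ _ _

theorem block_two_mul (h : IsLeja E) (o l : ℕ) (z : ℂ) :
    block E (2 * o) (2 * l) z = block (sqSeq E) o l (z ^ 2) := by
  rw [block, block, prod_range_two_mul]
  refine prod_congr rfl fun i _ => ?_
  rw [show 2 * o + (2 * i + 1) = 2 * (o + i) + 1 by ring, h.odd, sqSeq,
    show 2 * o + 2 * i = 2 * (o + i) by ring]
  ring

theorem block_two_pow_mul (h : IsLeja E) (a o l : ℕ) (z : ℂ) :
    block E (2 ^ a * o) (2 ^ a * l) z = block (sqSeq^[a] E) o l (z ^ 2 ^ a) := by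
  induction a generalizing E z with
  | zero => simp
  | succ a ih =>
    rw [pow_succ', mul_assoc, mul_assoc, block_two_mul h, ih h.sqSeq, ← pow_mul,
      Function.iterate_succ_apply]

/-- Pairing antipodal factors halves the block and squares `z`; each odd length met on the way
leaves one unpaired factor, of modulus at most `2`. The offset is a multiple of `2 ^ a` so that the
pairs stay aligned at every level. -/
theorem norm_block_le (h : IsLeja E) (a d l : ℕ) (hl : l ≤ 2 ^ a) {z : ℂ} (hz : ‖z‖ ≤ 1) :
    ‖block E (d * 2 ^ a) l z‖ ≤ 2 ^ sigmaOne l := by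
  have hone : ∀ {E : ℕ → ℂ}, IsLeja E → ∀ {z : ℂ}, ‖z‖ ≤ 1 → ∀ j, ‖z - E j‖ ≤ 2 := by
    intro E h z hz j
    calc ‖z - E j‖ ≤ ‖z‖ + ‖E j‖ := norm_sub_le _ _
      _ ≤ 2 := by linarith [h.norm_le j]
  induction a generalizing E l z with
  | zero =>
    obtain rfl | rfl : l = 0 ∨ l = 1 := by simp at hl; omega
    · simp [block, sigmaOne_zero]
    · simpa [block, sigmaOne_one] using hone h hz d
  | succ a ih =>
    have hz2 : ‖z ^ 2‖ ≤ 1 := by rw [norm_pow]; exact pow_le_one₀ (norm_nonneg _) hz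
    rw [pow_succ] at hl
    rw [show d * 2 ^ (a + 1) = 2 * (d * 2 ^ a) by ring]
    rcases Nat.even_or_odd' l with ⟨u, rfl | rfl⟩
    · rw [block_two_mul h, sigmaOne_two_mul]
      exact ih h.sqSeq u (by omega) hz2
    · rw [block_succ, block_two_mul h, sigmaOne_two_mul_add_one, norm_mul, pow_succ]
      exact mul_le_mul (ih h.sqSeq u (by omega) hz2) (hone h hz _) (norm_nonneg _) (pow_nonneg zero_le_two _)

/-- Induction on `a`, adding the terms at `y` and `-y`. For even `l` they coincide. For odd `l` the
unpaired root `e` gives `1/|y-e|² + 1/|y+e|² = 4/|y²-e²|²`, since `|y-e|² + |y+e|² = 4`, so the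
block of length `2u+1` becomes one of length `u+1` for the squared sequence. Thus `2^a - l` is
halved with rounding down and each odd step yields an extra factor `2`, which is how its digit sum
appears. -/
theorem sum_inv_norm_block_sq (h : IsLeja E) (a c d l : ℕ) (hl : 1 ≤ l) (hl' : l ≤ 2 ^ a)
    (hne : conj ((sqSeq^[a] E) c) ≠ (sqSeq^[a] E) d) :
    ∑ i ∈ range (2 ^ a), (‖block E (d * 2 ^ a) l (conj (E (c * 2 ^ a + i)))‖ ^ 2)⁻¹ =
      2 ^ a * 2 ^ sigmaOne (2 ^ a - l) / ‖conj ((sqSeq^[a] E) c) - (sqSeq^[a] E) d‖ ^ 2 := by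
  induction a generalizing E l with
  | zero =>
    obtain rfl : l = 1 := by simp at hl'; omega
    simp [block, sigmaOne_zero]
  | succ a ih =>
    rw [pow_succ] at hl'
    rw [Function.iterate_succ_apply] at hne ⊢
    have hlow := ih h.sqSeq
    have hc : ∀ i, c * 2 ^ (a + 1) + 2 * i = 2 * (c * 2 ^ a + i) := fun i => by ring
    have hc' : ∀ i, c * 2 ^ (a + 1) + (2 * i + 1) = 2 * (c * 2 ^ a + i) + 1 := fun i => by ring
    have hd : d * 2 ^ (a + 1) = 2 * (d * 2 ^ a) := by ring
    rw [show 2 ^ (a + 1) = 2 * 2 ^ a by ring, sum_range_two_mul, ← show 2 ^ (a + 1) = 2 * 2 ^ a by ring]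
    simp only [hc, hc', hd, h.odd, map_neg]
    rcases Nat.even_or_odd' l with ⟨u, rfl | rfl⟩
    · have := hlow u (by omega) (by omega) hne
      simp only [block_two_mul h, neg_sq, ← map_pow]
      rw [show 2 ^ (a + 1) - 2 * u = 2 * (2 ^ a - u) by rw [pow_succ]; omega, sigmaOne_two_mul,
        sum_congr rfl fun i _ => (two_mul _).symm, ← mul_sum]
      simp only [sqSeq] at this ⊢
      rw [this, pow_succ]; ring
    · have := hlow (u + 1) (by omega) (by omega) hne
      rw [show 2 ^ (a + 1) - (2 * u + 1) = 2 * (2 ^ a - (u + 1)) + 1 by rw [pow_succ]; omega,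
        sigmaOne_two_mul_add_one]
      have key : ∀ i ∈ range (2 ^ a),
          (‖block E (2 * (d * 2 ^ a)) (2 * u + 1) (conj (E (2 * (c * 2 ^ a + i))))‖ ^ 2)⁻¹ +
          (‖block E (2 * (d * 2 ^ a)) (2 * u + 1) (-conj (E (2 * (c * 2 ^ a + i))))‖ ^ 2)⁻¹ =
          4 * (‖block (sqSeq E) (d * 2 ^ a) (u + 1)
            (conj (sqSeq E (c * 2 ^ a + i)))‖ ^ 2)⁻¹ := by
        intro i hi
        have hs : conj (sqSeq E (c * 2 ^ a + i)) = conj (E (2 * (c * 2 ^ a + i))) ^ 2 := by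
          simp [sqSeq]
        have he : sqSeq E (d * 2 ^ a + u) = E (2 * (d * 2 ^ a) + 2 * u) ^ 2 := by
          simp [sqSeq, mul_add]
        have hnz : conj (sqSeq E (c * 2 ^ a + i)) ≠ sqSeq E (d * 2 ^ a + u) := by
          intro heq
          apply hne
          rw [← h.sqSeq.pow_eq' a c i (mem_range.1 hi), ← h.sqSeq.pow_eq' a d u (by omega),
            map_pow, heq]
        rw [hs] at hnz ⊢
        rw [he] at hnz
        rw [block_succ, block_succ, block_succ, block_two_mul h, block_two_mul h, he]
        set y := conj (E (2 * (c * 2 ^ a + i))) with hy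
        set e := E (2 * (d * 2 ^ a) + 2 * u) with hedef
        have hy1 : ‖y‖ = 1 := by rw [hy, RCLike.norm_conj, h.norm_eq]
        have he1 : ‖e‖ = 1 := h.norm_eq _
        have hf : y ^ 2 - e ^ 2 = (y - e) * (y + e) := by ring
        have h1 : ‖-y - e‖ = ‖y + e‖ := by rw [← norm_neg]; congr 1; ring
        have hp := parallelogram_law_with_norm ℝ y e
        rw [hy1, he1] at hp
        rw [neg_sq, hf]
        simp only [norm_mul, h1, mul_pow, mul_inv]
        have hz := sub_ne_zero.2 hnz
        rw [hf] at hz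
        have ha : ‖y - e‖ ≠ 0 := norm_ne_zero_iff.2 (left_ne_zero_of_mul hz)
        have hb : ‖y + e‖ ≠ 0 := norm_ne_zero_iff.2 (right_ne_zero_of_mul hz)
        have hab : (‖y - e‖ ^ 2)⁻¹ + (‖y + e‖ ^ 2)⁻¹ =
            4 * ((‖y - e‖ ^ 2)⁻¹ * (‖y + e‖ ^ 2)⁻¹) := by
          field_simp; linarith
        rw [← mul_add, hab]; ring
      rw [sum_congr rfl key, ← mul_sum, this, pow_succ, pow_succ]; ring

/-! ### The quadratic Lebesgue function -/

/-- The modulus at `z` of the Lagrange polynomial of index `i` for the nodes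
`E 0, …, E (k - 1)`. -/
noncomputable def lagN (E : ℕ → ℂ) (k i : ℕ) (z : ℂ) : ℝ :=
  ∏ j ∈ range k, if j = i then 1 else ‖z - E j‖ / ‖E i - E j‖

/-- The sum of the squared moduli of the Lagrange polynomials. -/
noncomputable def quad (E : ℕ → ℂ) (k : ℕ) (z : ℂ) : ℝ := ∑ i ∈ range k, lagN E k i z ^ 2

theorem lagN_nonneg (E : ℕ → ℂ) (k i : ℕ) (z : ℂ) : 0 ≤ lagN E k i z :=
  prod_nonneg fun j _ => by split_ifs <;> positivity

/-- Each antipodal pair of nodes other than the one containing `i'` merges into a factor in `z ^ 2`;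
the partner `-E i'` leaves the factor `‖z + E i'‖ / 2`. -/
theorem lagN_two_mul_aux (h : IsLeja E) {k i : ℕ} (hi : i < k) (z : ℂ) (i' : ℕ)
    (hi' : i' = 2 * i ∨ i' = 2 * i + 1) :
    lagN E (2 * k) i' z = lagN (sqSeq E) k i (z ^ 2) * (‖z + E i'‖ / 2) := by
  have hE : E i' ^ 2 = sqSeq E i := by
    rw [h.sq_eq]; congr 1; omega
  have h2 : ‖E i' + E i'‖ = 2 := by rw [← two_mul, norm_mul, h.norm_eq]; simp
  rw [lagN, lagN, prod_range_two_mul]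
  have : (‖z + E i'‖ / 2 : ℝ) = ∏ j ∈ range k, if j = i then ‖z + E i'‖ / 2 else 1 := by
    rw [prod_ite_eq' (range k) i fun _ => ‖z + E i'‖ / 2, if_pos (mem_range.2 hi)]
  rw [this, ← prod_mul_distrib]
  refine prod_congr rfl fun j _ => ?_
  by_cases hj : j = i
  · subst hj
    rcases hi' with rfl | rfl
    · simp [h.odd, sub_neg_eq_add, h2]
    · have h3 : ‖-E (2 * j) - E (2 * j)‖ = 2 := by
        rw [h.odd] at h2; rw [← h2]; congr 1
      rw [if_neg (by omega : 2 * j ≠ 2 * j + 1)]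
      simp only [if_true, one_mul, mul_one]
      rw [h.odd, ← sub_eq_add_neg, h3]
  · rw [if_neg (by omega), if_neg (by omega), if_neg hj, if_neg hj, mul_one, h.odd, div_mul_div_comm,
      ← norm_mul, ← norm_mul, ← hE, sqSeq]
    congr 2 <;> ring

/-- The squared weights `‖z ± E (2i)‖² / 4` of the two nodes of a pair add up to `1` by the
parallelogram law. -/
theorem quad_two_mul (h : IsLeja E) (k : ℕ) {z : ℂ} (hz : ‖z‖ = 1) :
    quad E (2 * k) z = quad (sqSeq E) k (z ^ 2) := by
  rw [quad, sum_range_two_mul, quad]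
  refine sum_congr rfl fun i hi => ?_
  rw [lagN_two_mul_aux h (mem_range.1 hi) z _ (.inl rfl),
    lagN_two_mul_aux h (mem_range.1 hi) z _ (.inr rfl), h.odd, ← sub_eq_add_neg]
  have hp := parallelogram_law_with_norm ℝ z (E (2 * i))
  rw [hz, h.norm_eq] at hp
  linear_combination lagN (sqSeq E) k i (z ^ 2) ^ 2 / 4 * hp

theorem lagN_succ_of_lt (E : ℕ → ℂ) {k i : ℕ} (hi : i < k) (z : ℂ) :
    lagN E (k + 1) i z = lagN E k i z * (‖z - E k‖ / ‖E i - E k‖) := by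
  rw [lagN, prod_range_succ, if_neg hi.ne', lagN]

theorem lagN_succ_self (E : ℕ → ℂ) (k : ℕ) (z : ℂ) :
    lagN E (k + 1) k z = (∏ j ∈ range k, ‖z - E j‖) / ∏ j ∈ range k, ‖E k - E j‖ := by
  rw [lagN, prod_range_succ, if_pos rfl, mul_one, ← prod_div_distrib]
  exact prod_congr rfl fun j hj => if_neg (mem_range.1 hj).ne

/-- Even sections descend to the squared sequence without change. In the odd case the point of
evaluation is the antipode of the last node, which gives `q ↦ 2q + 1`, so `q + 1` doubles. -/
theorem quad_self (h : IsLeja E) (k : ℕ) : quad E k (E k) + 1 = 2 ^ sigmaOne k := by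
  induction k using Nat.strong_induction_on generalizing E with
  | _ k ih =>
    rcases Nat.eq_zero_or_pos k with rfl | hk
    · simp [quad, sigmaOne_zero]
    rcases Nat.even_or_odd' k with ⟨u, rfl | rfl⟩
    · rw [quad_two_mul h u (h.norm_eq _), sigmaOne_two_mul]
      exact ih u (by omega) h.sqSeq
    · have hq : quad E (2 * u + 1) (E (2 * u + 1)) =
          2 * quad (sqSeq E) u (sqSeq E u) + 1 := by
        rw [quad, sum_range_succ, sum_range_two_mul, quad, mul_sum]
        congr 1
        · refine sum_congr rfl fun i hi => ?_
          have hi := mem_range.1 hi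
          rw [lagN_succ_of_lt E (by omega), lagN_succ_of_lt E (by omega),
            lagN_two_mul_aux h hi _ _ (.inl rfl), lagN_two_mul_aux h hi _ _ (.inr rfl),
            h.odd, h.odd, neg_sq]
          have h2 : ‖-E (2 * u) - E (2 * u)‖ = 2 := by
            rw [show -E (2 * u) - E (2 * u) = -(2 * E (2 * u)) by ring, norm_neg, norm_mul,
              h.norm_eq]
            simp
          have h3 : ‖-E (2 * u) + E (2 * i)‖ = ‖E (2 * i) - E (2 * u)‖ := by
            congr 1; ring
          have h4 : ‖-E (2 * u) + -E (2 * i)‖ = ‖-E (2 * i) - E (2 * u)‖ := by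
            congr 1; ring
          have h5 : ‖E (2 * i) - E (2 * u)‖ ≠ 0 :=
            norm_ne_zero_iff.2 (sub_ne_zero.2 (h.injective.ne (by omega)))
          have h6 : ‖-E (2 * i) - E (2 * u)‖ ≠ 0 := by
            rw [← h.odd]
            exact norm_ne_zero_iff.2 (sub_ne_zero.2 (h.injective.ne (by omega)))
          rw [h2, h3, h4, show E (2 * u) ^ 2 = sqSeq E u from rfl]
          field_simp
          ring
        · rw [lagN_succ_self, h.odd, h.prod_two_mul, h.prod_two_mul, neg_sq, ← h.prod_two_mul,
            div_self (h.prod_pos _).ne', one_pow]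
      have := ih u (by omega) h.sqSeq
      rw [hq, sigmaOne_two_mul_add_one, pow_succ, ← this]
      ring

/-- Up to a factor independent of `z`, the left side is the nodal product, and `E k` maximizes that.
-/
theorem lagN_mul_norm_le (h : IsLeja E) {k i : ℕ} (hi : i < k) {z : ℂ} (hz : ‖z‖ ≤ 1) :
    lagN E k i z * ‖z - E i‖ ≤ lagN E k i (E k) * ‖E k - E i‖ := by
  have key : ∀ y : ℂ, lagN E k i y * ‖y - E i‖ =
      (∏ j ∈ range k, ‖y - E j‖) / ∏ j ∈ range k, if j = i then 1 else ‖E i - E j‖ := by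
    intro y
    have : ‖y - E i‖ = ∏ j ∈ range k, if j = i then ‖y - E i‖ else 1 := by
      rw [prod_ite_eq' (range k) i fun _ => ‖y - E i‖, if_pos (mem_range.2 hi)]
    rw [this, lagN, ← prod_mul_distrib, ← prod_div_distrib]
    refine prod_congr rfl fun j _ => ?_
    split_ifs with hj
    · simp [hj]
    · simp
  rw [key, key]
  exact div_le_div_of_nonneg_right (h.le k z hz)
    (prod_nonneg fun j _ => by split_ifs <;> positivity)

theorem quad_le (h : IsLeja E) (k : ℕ) {z : ℂ} (hz : ‖z‖ = 1) :
    quad E k z ≤ 6 * 2 ^ sigmaOne k := by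
  induction k using Nat.strong_induction_on generalizing E z with
  | _ k ih =>
    rcases Nat.eq_zero_or_pos k with rfl | hk
    · simp [quad, sigmaOne_zero]
    rcases Nat.even_or_odd' k with ⟨u, rfl | rfl⟩
    · rw [quad_two_mul h u hz, sigmaOne_two_mul]
      exact ih u (by omega) h.sqSeq (by simp [hz])
    · have hpos : (1 : ℝ) ≤ 2 ^ sigmaOne u := one_le_pow₀ one_le_two
      have hz' : quad E (2 * u) z ≤ 6 * 2 ^ sigmaOne u := by
        rw [quad_two_mul h u hz]
        rcases Nat.eq_zero_or_pos u with rfl | hu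
        · simp [quad]
        · exact ih u (by omega) h.sqSeq (by simp [hz])
      have he := quad_self h (2 * u)
      rw [sigmaOne_two_mul] at he
      have hlast : lagN E (2 * u + 1) (2 * u) z ≤ 1 := by
        rw [lagN_succ_self]
        exact div_le_one_of_le₀ (h.le _ z hz.le) (h.prod_pos _).le
      -- `(a + b)² ≤ 3/2 a² + 3 b²`, the difference being `(a - 2b)² / 2`. With `quad_self` for the
      -- `b` terms, the constant `C` of the bound has to satisfy `3/2 C + 3 ≤ 2C`, whence the `6`.
      have hterm : ∀ i ∈ range (2 * u), lagN E (2 * u + 1) i z ^ 2 ≤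
          3 / 2 * lagN E (2 * u) i z ^ 2 + 3 * lagN E (2 * u) i (E (2 * u)) ^ 2 := by
        intro i hi
        have hi := mem_range.1 hi
        have hp : 0 < ‖E i - E (2 * u)‖ :=
          norm_pos_iff.2 (sub_ne_zero.2 (h.injective.ne hi.ne))
        have h1 : lagN E (2 * u + 1) i z ≤ lagN E (2 * u) i z + lagN E (2 * u) i (E (2 * u)) := by
          rw [lagN_succ_of_lt E hi, ← mul_div_assoc, div_le_iff₀ hp]
          -- Splitting `z - E (2u)` through `E i` leaves one summand in which `‖z - E i‖` completes
          -- the Lagrange product to the nodal product.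
          have h2 := lagN_mul_norm_le h hi hz.le
          have h3 : ‖z - E (2 * u)‖ ≤ ‖z - E i‖ + ‖E i - E (2 * u)‖ := norm_sub_le_norm_sub_add_norm_sub _ _ _
          have h4 := mul_le_mul_of_nonneg_left h3 (lagN_nonneg E (2 * u) i z)
          rw [norm_sub_rev (E (2 * u))] at h2
          linarith
        have h5 := lagN_nonneg E (2 * u + 1) i z
        have h6 := pow_le_pow_left₀ h5 h1 2
        nlinarith [sq_nonneg (lagN E (2 * u) i z - 2 * lagN E (2 * u) i (E (2 * u)))]
      have hsum := sum_le_sum hterm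
      rw [sum_add_distrib, ← mul_sum, ← mul_sum] at hsum
      have hl2 := pow_le_one₀ (n := 2) (lagN_nonneg E (2 * u + 1) (2 * u) z) hlast
      rw [sigmaOne_two_mul_add_one, pow_succ, quad, sum_range_succ]
      unfold quad at he hz'
      linarith


/-! ### Lebesgue functions as functions of the set of nodes -/

section LagSet

variable {𝕜 : Type*} [NormedField 𝕜] [DecidableEq 𝕜]

/-- The modulus at `z` of the Lagrange polynomial of the node `s` for the set of nodes `S`. -/
noncomputable def lagSet (S : Finset 𝕜) (s z : 𝕜) : ℝ := ∏ t ∈ S.erase s, ‖z - t‖ / ‖s - t‖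

theorem lagSet_nonneg (S : Finset 𝕜) (s z : 𝕜) : 0 ≤ lagSet S s z :=
  prod_nonneg fun _ _ => by positivity

theorem lagSet_image {ι : Type*} [DecidableEq ι] (I : Finset ι) {f : ι → 𝕜}
    (hf : Set.InjOn f I) {i : ι} (hi : i ∈ I) (z : 𝕜) :
    lagSet (I.image f) (f i) z = ∏ j ∈ I, if j = i then 1 else ‖z - f j‖ / ‖f i - f j‖ := by
  have : (I.image f).erase (f i) = (I.erase i).image f := by
    ext t
    simp only [mem_erase, mem_image, ne_eq]
    constructor
    · rintro ⟨ht, j, hj, rfl⟩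
      exact ⟨j, ⟨fun h => ht (by rw [h]), hj⟩, rfl⟩
    · rintro ⟨j, ⟨hji, hj⟩, rfl⟩
      exact ⟨fun h => hji (hf hj hi h), j, hj, rfl⟩
  rw [lagSet, this, prod_image (fun a ha b hb hab => hf (mem_of_mem_erase ha) (mem_of_mem_erase hb) hab),
    ← mul_prod_erase I _ hi, if_pos rfl, one_mul]
  exact prod_congr rfl fun j hj => (if_neg (ne_of_mem_erase hj)).symm

theorem lagSet_image_mul (S : Finset 𝕜) {c : 𝕜} (hc : c ≠ 0) {s : 𝕜} (hs : s ∈ S) (z : 𝕜) :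
    lagSet (S.image fun t => c * t) (c * s) (c * z) = lagSet S s z := by
  rw [lagSet_image S (f := fun t => c * t) (fun a _ b _ h => mul_left_cancel₀ hc h) hs (c * z)]
  have h2 := lagSet_image S (f := fun t => t) (fun a _ b _ h => h) hs z
  rw [image_id'] at h2
  rw [h2]
  refine prod_congr rfl fun j _ => ?_
  rw [← mul_sub, ← mul_sub, norm_mul, norm_mul, mul_div_mul_left _ _ (norm_ne_zero_iff.2 hc)]

theorem lagSet_self (S : Finset 𝕜) (s : 𝕜) : lagSet S s s = 1 := by
  refine prod_eq_one fun t ht => div_self ?_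
  exact norm_ne_zero_iff.2 (sub_ne_zero.2 (ne_of_mem_erase ht).symm)

theorem lagSet_of_ne (S : Finset 𝕜) {s z : 𝕜} (hz : z ∈ S) (hne : z ≠ s) : lagSet S s z = 0 :=
  prod_eq_zero (mem_erase.2 ⟨hne, hz⟩) (by simp)

theorem sum_lagSet_of_mem (S : Finset 𝕜) {z : 𝕜} (hz : z ∈ S) : ∑ s ∈ S, lagSet S s z = 1 := by
  rw [sum_eq_single_of_mem z hz fun s _ hs => lagSet_of_ne S hz hs.symm, lagSet_self]

end LagSet

theorem lebesgueFunction_eq {𝕜 : Type*} [RCLike 𝕜] [DecidableEq 𝕜] {X : Set 𝕜} {ι : Type*}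
    [Fintype ι] [DecidableEq ι] (v : ι → X) (hv : Function.Injective v) (z : X) {S : Finset 𝕜}
    (hS : univ.image (fun i => (v i : 𝕜)) = S) :
    lebesgueFunction v z = ∑ s ∈ S, lagSet S s z := by
  have hinj : Function.Injective fun i => (v i : 𝕜) := Subtype.val_injective.comp hv
  subst hS
  rw [sum_image hinj.injOn]
  refine sum_congr rfl fun i _ => ?_
  rw [lagSet_image univ hinj.injOn (mem_univ i), lagrangePoly, Lagrange.basis,
    Polynomial.eval_prod, norm_prod, ← mul_prod_erase univ _ (mem_univ i), if_pos rfl, one_mul]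
  refine prod_congr rfl fun j hj => ?_
  rw [if_neg (ne_of_mem_erase hj), Lagrange.basisDivisor]
  simp [div_eq_inv_mul]

theorem lagN_eq_lagSet {E : ℕ → ℂ} (hE : Function.Injective E) {k i : ℕ} (hi : i < k) (z : ℂ) :
    lagN E k i z = lagSet ((range k).image E) (E i) z :=
  (lagSet_image _ hE.injOn (mem_range.2 hi) z).symm

/-! ### Roots of unity -/

/-- This identifies aligned blocks of `E` with cosets of roots of unity: both consist of `N`
solutions of the same equation `x ^ N = a`. -/
theorem eq_of_card_of_pow_eq {N : ℕ} (hN : 0 < N) {a : ℂ} {S T : Finset ℂ} (hS : S.card = N)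
    (hT : T.card = N) (hSa : ∀ x ∈ S, x ^ N = a) (hTa : ∀ x ∈ T, x ^ N = a) : S = T := by
  have key : ∀ U : Finset ℂ, U.card = N → (∀ x ∈ U, x ^ N = a) →
      U = (Polynomial.nthRoots N a).toFinset := by
    intro U hU hUa
    refine eq_of_subset_of_card_le (fun x hx => ?_) ?_
    · rw [Multiset.mem_toFinset, Polynomial.mem_nthRoots hN]; exact hUa x hx
    · rw [hU]; exact (Multiset.toFinset_card_le _).trans (Polynomial.card_nthRoots N a)
  rw [key S hS hSa, key T hT hTa]

theorem unityRoots_pow (N : ℕ) (hN : 0 < N) (j : Fin N) : (unityRoots N j : ℂ) ^ N = 1 := by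
  have hN' : (N : ℂ) ≠ 0 := by exact_mod_cast hN.ne'
  rw [unityRoots, ← Complex.exp_nat_mul, Complex.exp_eq_one_iff]
  refine ⟨j, ?_⟩
  push_cast
  field_simp

theorem unityRoots_injective (N : ℕ) (hN : 0 < N) : Function.Injective (unityRoots N) := by
  intro i j h
  have h1 := congrArg (fun x : Disc => (x : ℂ)) h
  simp only [unityRoots] at h1
  have h2 := (Complex.isPrimitiveRoot_exp N hN.ne').pow_inj i.2 j.2
  apply Fin.ext
  apply h2
  rw [← Complex.exp_nat_mul, ← Complex.exp_nat_mul]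
  convert h1 using 2
  all_goals
    push_cast
    ring

/-- The set of the `N`-th roots of unity. -/
noncomputable def unitySet (N : ℕ) : Finset ℂ := univ.image fun j => (unityRoots N j : ℂ)

theorem card_unitySet (N : ℕ) (hN : 0 < N) : (unitySet N).card = N := by
  have hinj : Function.Injective fun j => (unityRoots N j : ℂ) :=
    Subtype.val_injective.comp (unityRoots_injective N hN)
  rw [unitySet, card_image_of_injective _ hinj, card_univ, Fintype.card_fin]

theorem pow_of_mem_unitySet {N : ℕ} (hN : 0 < N) {x : ℂ} (hx : x ∈ unitySet N) : x ^ N = 1 := by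
  obtain ⟨j, -, rfl⟩ := mem_image.1 hx
  exact unityRoots_pow N hN j

theorem sum_lagSet_unitySet_le (p : ℕ) {z : ℂ} (hz : ‖z‖ ≤ 1) :
    ∑ s ∈ unitySet (2 ^ p), lagSet (unitySet (2 ^ p)) s z ≤ lebesgueRoots p := by
  have : Nonempty Disc := ⟨⟨0, by simp⟩⟩
  have hinj := unityRoots_injective (2 ^ p) (by positivity)
  have h := (isGreatest_lebesgueConstant (unityRoots (2 ^ p)) hinj).2 ⟨⟨z, by simpa using hz⟩, rfl⟩
  rwa [lebesgueFunction_eq _ hinj _ (S := unitySet (2 ^ p)) rfl] at h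

theorem exists_sum_lagSet_unitySet_eq (p : ℕ) : ∃ z : ℂ, ‖z‖ ≤ 1 ∧
    ∑ s ∈ unitySet (2 ^ p), lagSet (unitySet (2 ^ p)) s z = lebesgueRoots p := by
  have : Nonempty Disc := ⟨⟨0, by simp⟩⟩
  have hinj := unityRoots_injective (2 ^ p) (by positivity)
  obtain ⟨z, hz⟩ := (isGreatest_lebesgueConstant (unityRoots (2 ^ p)) hinj).1
  refine ⟨z, mem_closedBall_zero_iff.1 z.2, ?_⟩
  rw [lebesgueFunction_eq _ hinj _ (S := unitySet (2 ^ p)) rfl] at hz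
  exact hz

theorem one_le_lebesgueRoots (p : ℕ) : 1 ≤ lebesgueRoots p := by
  have h0 : (unityRoots (2 ^ p) ⟨0, by positivity⟩ : ℂ) ∈ unitySet (2 ^ p) :=
    mem_image_of_mem _ (mem_univ _)
  have := sum_lagSet_unitySet_le p (z := (unityRoots (2 ^ p) ⟨0, by positivity⟩ : ℂ))
    (mem_closedBall_zero_iff.1 (unityRoots (2 ^ p) ⟨0, by positivity⟩).2)
  rwa [sum_lagSet_of_mem _ h0] at this

/-! ### Reduction to sections of odd length -/

theorem prod_range_mul_block {M : Type*} [CommMonoid M] (f : ℕ → M) (m P : ℕ) :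
    ∏ i ∈ range (m * P), f i = ∏ j ∈ range m, ∏ i ∈ range P, f (j * P + i) := by
  induction m with
  | zero => simp
  | succ m ih => rw [Nat.succ_mul, prod_range_add, ih, prod_range_succ]

theorem sum_range_mul_block {M : Type*} [AddCommMonoid M] (f : ℕ → M) (m P : ℕ) :
    ∑ i ∈ range (m * P), f i = ∑ j ∈ range m, ∑ i ∈ range P, f (j * P + i) := by
  induction m with
  | zero => simp
  | succ m ih => rw [Nat.succ_mul, sum_range_add, ih, sum_range_succ]

theorem prod_block (h : IsLeja E) (p j : ℕ) (z : ℂ) :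
    ∏ i ∈ range (2 ^ p), (z - E (j * 2 ^ p + i)) = z ^ 2 ^ p - (sqSeq^[p] E) j := by
  have := block_two_pow_mul h p j 1 z
  rw [mul_one, mul_comm] at this
  simpa [block] using this

/-- The factors from a foreign coset multiply to a difference of `2^p`-th powers, hence to one
factor of the iterated squared sequence; the node's own coset contributes its own Lagrange
polynomial. -/
theorem lagN_mul_two_pow (h : IsLeja E) (p m : ℕ) {j i : ℕ} (hj : j < m) (hi : i < 2 ^ p) (z : ℂ) :
    lagN E (m * 2 ^ p) (j * 2 ^ p + i) z = lagN (sqSeq^[p] E) m j (z ^ 2 ^ p) *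
      ∏ i' ∈ range (2 ^ p), if i' = i then 1 else
        ‖z - E (j * 2 ^ p + i')‖ / ‖E (j * 2 ^ p + i) - E (j * 2 ^ p + i')‖ := by
  have hc : (∏ i' ∈ range (2 ^ p), if i' = i then 1 else
        ‖z - E (j * 2 ^ p + i')‖ / ‖E (j * 2 ^ p + i) - E (j * 2 ^ p + i')‖) =
      ∏ j' ∈ range m, if j' = j then (∏ i' ∈ range (2 ^ p), if i' = i then 1 else
        ‖z - E (j * 2 ^ p + i')‖ / ‖E (j * 2 ^ p + i) - E (j * 2 ^ p + i')‖) else 1 := by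
    rw [prod_ite_eq' (range m) j fun _ => _, if_pos (mem_range.2 hj)]
  rw [hc, lagN, lagN, prod_range_mul_block, ← prod_mul_distrib]
  refine prod_congr rfl fun j' _ => ?_
  by_cases hjj : j' = j
  · subst hjj
    simp
  · rw [if_neg hjj, if_neg hjj, mul_one, ← h.pow_eq' p j i hi, ← prod_block h, ← prod_block h,
      norm_prod, norm_prod, ← prod_div_distrib]
    refine prod_congr rfl fun i' hi' => if_neg fun heq => hjj ?_
    have hi' := mem_range.1 hi'
    have h1 := congrArg (fun t => t / 2 ^ p) heq
    simp only [Nat.add_comm (_ * 2 ^ p)] at h1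
    rwa [Nat.add_mul_div_right _ _ (by positivity), Nat.add_mul_div_right _ _ (by positivity),
      Nat.div_eq_of_lt hi', Nat.div_eq_of_lt hi, zero_add, zero_add] at h1

/-- The block is a rotation of the roots of unity, and Lagrange polynomials are invariant under
rotation of nodes and point together. -/
theorem sum_coset_le (h : IsLeja E) (p j : ℕ) {z : ℂ} (hz : ‖z‖ ≤ 1) :
    ∑ i ∈ range (2 ^ p), (∏ i' ∈ range (2 ^ p), if i' = i then 1 else
      ‖z - E (j * 2 ^ p + i')‖ / ‖E (j * 2 ^ p + i) - E (j * 2 ^ p + i')‖) ≤ lebesgueRoots p := by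
  set f : ℕ → ℂ := fun i => E (j * 2 ^ p + i) with hf
  have hinj : Function.Injective f := fun a b hab => by simpa using h.injective hab
  have hset : (range (2 ^ p)).image f = (unitySet (2 ^ p)).image fun t => f 0 * t := by
    refine eq_of_card_of_pow_eq (N := 2 ^ p) (a := (sqSeq^[p] E) j) (by positivity) ?_ ?_ ?_ ?_
    · rw [card_image_of_injective _ hinj, card_range]
    · rw [card_image_of_injective _ (mul_right_injective₀ (h.ne_zero _)),
        card_unitySet _ (by positivity)]
    · simp only [mem_image, mem_range, forall_exists_index, and_imp]
      rintro x i hi rfl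
      exact h.pow_eq' p j i hi
    · simp only [mem_image, forall_exists_index, and_imp]
      rintro x i hi rfl
      rw [mul_pow, pow_of_mem_unitySet (by positivity) hi, mul_one]
      exact h.pow_eq' p j 0 (by positivity)
  have h1 : ∀ i ∈ range (2 ^ p), (∏ i' ∈ range (2 ^ p), if i' = i then 1 else
      ‖z - E (j * 2 ^ p + i')‖ / ‖E (j * 2 ^ p + i) - E (j * 2 ^ p + i')‖) =
      lagSet ((range (2 ^ p)).image f) (f i) z := fun i hi => (lagSet_image _ hinj.injOn hi z).symm
  rw [sum_congr rfl h1, ← sum_image (f := fun s => lagSet ((range (2 ^ p)).image f) s z) hinj.injOn,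
    hset, sum_image (mul_right_injective₀ (h.ne_zero _)).injOn]
  refine le_trans (le_of_eq ?_) (sum_lagSet_unitySet_le p (z := z / f 0) ?_)
  · refine sum_congr rfl fun s hs => ?_
    rw [← lagSet_image_mul _ (h.ne_zero (j * 2 ^ p + 0)) hs]
    congr 1
    exact (mul_div_cancel₀ _ (h.ne_zero _)).symm
  · rw [norm_div, hf]; simpa [h.norm_eq] using hz

/-- The weight is constant on each coset, so it factors out and every inner sum is at most
`𝕃_{2^p}`. -/
theorem sum_lagN_mul_le (h : IsLeja E) (p m : ℕ) {z : ℂ} (hz : ‖z‖ ≤ 1) {φ : ℂ → ℝ}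
    (hφ : ∀ y, 0 ≤ φ y) :
    ∑ i ∈ range (m * 2 ^ p), lagN E (m * 2 ^ p) i z * φ (E i ^ 2 ^ p) ≤
      lebesgueRoots p * ∑ j ∈ range m, lagN (sqSeq^[p] E) m j (z ^ 2 ^ p) * φ ((sqSeq^[p] E) j) := by
  rw [sum_range_mul_block, mul_sum]
  refine sum_le_sum fun j hj => ?_
  have hj := mem_range.1 hj
  have h1 : ∀ i ∈ range (2 ^ p), lagN E (m * 2 ^ p) (j * 2 ^ p + i) z *
      φ (E (j * 2 ^ p + i) ^ 2 ^ p) = (lagN (sqSeq^[p] E) m j (z ^ 2 ^ p) * φ ((sqSeq^[p] E) j)) *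
      ∏ i' ∈ range (2 ^ p), if i' = i then 1 else
        ‖z - E (j * 2 ^ p + i')‖ / ‖E (j * 2 ^ p + i) - E (j * 2 ^ p + i')‖ := by
    intro i hi
    rw [lagN_mul_two_pow h p m hj (mem_range.1 hi), h.pow_eq' p j i (mem_range.1 hi)]
    ring
  rw [sum_congr rfl h1, ← mul_sum, mul_comm]
  exact mul_le_mul_of_nonneg_right (sum_coset_le h p j hz)
    (mul_nonneg (lagN_nonneg _ _ _ _) (hφ _))

/-! ### Cauchy-Schwarz estimate for odd and general `l` -/

theorem sum_inv_norm_block_sq_le (h : IsLeja E) (n l : ℕ) (hl : Odd l) (hln : l < 2 ^ n) :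
    ∑ j ∈ range (2 ^ (n + 1) + l), (‖block E (2 ^ (n + 1)) l (conj (E j))‖ ^ 2)⁻¹ ≤
      5 / 4 * 2 ^ n * 2 ^ sigmaOne (2 ^ n - l) := by
  set F := sqSeq^[n] E with hFdef
  have hF : IsLeja F := h.iterate_sqSeq n
  have h0 : F 0 = 1 := hF.zero
  have h1 : F 1 = -1 := hF.one_eq
  have hl1 : 1 ≤ l := hl.pos
  have hn1 : F 2 * F 2 = -1 := by rw [← sq]; exact hF.two_sq
  -- `F 2` is `i` or `-i`, so its squared distances to `conj (F 0)`, `conj (F 1)`, `conj (F 2)` are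
  -- `2`, `2`, `4`; the constant is `5/4 = 1/2 + 1/2 + 1/4`.
  have hre : (F 2).re = 0 := by
    have h2 := congrArg Complex.re hn1
    have h3 := congrArg Complex.im hn1
    simp only [Complex.mul_re, Complex.mul_im, Complex.neg_re, Complex.neg_im, Complex.one_re,
      Complex.one_im] at h2 h3
    nlinarith [sq_nonneg (F 2).re, sq_nonneg (F 2).im]
  have him : (F 2).im ^ 2 = 1 := by
    have h2 := congrArg Complex.re hn1
    simp only [Complex.mul_re, Complex.neg_re, Complex.one_re] at h2
    rw [hre] at h2; nlinarith
  have hd : ∀ c, ‖conj (F c) - F 2‖ ^ 2 = (F c).re ^ 2 + ((F c).im + (F 2).im) ^ 2 := by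
    intro c
    rw [Complex.sq_norm, Complex.normSq_apply]
    simp [hre]; ring
  have hd0 : ‖conj (F 0) - F 2‖ ^ 2 = 2 := by rw [hd, h0]; simp [him]; norm_num
  have hd1 : ‖conj (F 1) - F 2‖ ^ 2 = 2 := by rw [hd, h1]; simp [him]; norm_num
  have hd2 : ‖conj (F 2) - F 2‖ ^ 2 = 4 := by rw [hd, hre]; nlinarith
  have key : ∀ c, ‖conj (F c) - F 2‖ ^ 2 ≠ 0 →
      ∑ i ∈ range (2 ^ n), (‖block E (2 ^ (n + 1)) l (conj (E (c * 2 ^ n + i)))‖ ^ 2)⁻¹ =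
      2 ^ n * 2 ^ sigmaOne (2 ^ n - l) / ‖conj (F c) - F 2‖ ^ 2 := by
    intro c hc
    rw [pow_succ' 2 n]
    refine sum_inv_norm_block_sq h n c 2 l hl1 hln.le ?_
    intro heq
    rw [← hFdef] at heq
    rw [heq] at hc; simp at hc
  -- The incomplete last block is filled up to three full blocks of length `2 ^ n`, on each of which
  -- the exact formula applies.
  have hle : ∑ j ∈ range (2 ^ (n + 1) + l), (‖block E (2 ^ (n + 1)) l (conj (E j))‖ ^ 2)⁻¹ ≤
      ∑ j ∈ range (3 * 2 ^ n), (‖block E (2 ^ (n + 1)) l (conj (E j))‖ ^ 2)⁻¹ := by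
    refine sum_le_sum_of_subset_of_nonneg (range_mono ?_) fun _ _ _ => by positivity
    rw [pow_succ]; omega
  refine hle.trans (le_of_eq ?_)
  rw [sum_range_mul_block, sum_range_succ, sum_range_succ, sum_range_succ, range_zero, sum_empty,
    key 0 (by rw [hd0]; norm_num), key 1 (by rw [hd1]; norm_num), key 2 (by rw [hd2]; norm_num),
    hd0, hd1, hd2]
  ring

theorem sum_lagN_div_le_of_odd (h : IsLeja E) (n l : ℕ) (hl : Odd l) (hln : l < 2 ^ n) {z : ℂ}
    (hz : ‖z‖ = 1) :
    ∑ j ∈ range (2 ^ (n + 1) + l), lagN E (2 ^ (n + 1) + l) j z *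
      ‖block E (2 ^ (n + 1)) l (conj (E j))‖⁻¹ ≤ 3 * Real.sqrt 5 * 2 ^ n := by
  have hcs := sum_mul_sq_le_sq_mul_sq (range (2 ^ (n + 1) + l))
    (fun j => lagN E (2 ^ (n + 1) + l) j z)
    (fun j => ‖block E (2 ^ (n + 1)) l (conj (E j))‖⁻¹)
  have h1 : ∑ j ∈ range (2 ^ (n + 1) + l), lagN E (2 ^ (n + 1) + l) j z ^ 2 ≤
      6 * 2 ^ (sigmaOne l + 1) := by
    rw [← sigmaOne_two_pow_add (n + 1) l (by rw [pow_succ]; omega)]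
    exact quad_le h _ hz
  have h2 := sum_inv_norm_block_sq_le h n l hl hln
  have h3 := sigmaOne_two_pow_sub n l hl hln
  simp only [inv_pow] at hcs
  have h4 := hcs.trans (mul_le_mul h1 h2 (sum_nonneg fun _ _ => by positivity) (by positivity))
  refine abs_le_of_sq_le_sq' (h4.trans ?_) (by positivity) |>.2
  have h5 : (6 * 2 ^ (sigmaOne l + 1) * (5 / 4 * 2 ^ n * 2 ^ sigmaOne (2 ^ n - l)) : ℝ) =
      30 * (2 ^ n) ^ 2 := by
    have : (2 : ℝ) ^ sigmaOne (2 ^ n - l) * 2 ^ sigmaOne l = 2 * 2 ^ n := by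
      rw [← pow_add, h3, pow_succ']
    rw [pow_succ]
    linear_combination 15 * 2 ^ n * this
  -- It remains that `30 ≤ 45 = (3√5)²`.
  rw [h5, mul_pow, mul_pow, Real.sq_sqrt (by norm_num)]
  nlinarith [sq_nonneg ((2 : ℝ) ^ n)]

theorem sum_lagN_div_le (h : IsLeja E) (n p l : ℕ) (hl : Odd l) (hln : 2 ^ p * l < 2 ^ (p + n))
    {z : ℂ} (hz : ‖z‖ = 1) :
    ∑ j ∈ range (2 ^ (p + n + 1) + 2 ^ p * l), lagN E (2 ^ (p + n + 1) + 2 ^ p * l) j z *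
      ‖block E (2 ^ (p + n + 1)) (2 ^ p * l) (conj (E j))‖⁻¹ ≤
      3 * Real.sqrt 5 * 2 ^ n * lebesgueRoots p := by
  have hln' : l < 2 ^ n := by
    rw [pow_add] at hln
    exact lt_of_mul_lt_mul_left hln (by positivity)
  have hN : 2 ^ (p + n + 1) = 2 ^ p * 2 ^ (n + 1) := by rw [add_assoc, pow_add]
  have hk : 2 ^ (p + n + 1) + 2 ^ p * l = (2 ^ (n + 1) + l) * 2 ^ p := by rw [hN]; ring
  have h1 := sum_lagN_mul_le h p (2 ^ (n + 1) + l) hz.le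
    (φ := fun y => ‖block (sqSeq^[p] E) (2 ^ (n + 1)) l (conj y)‖⁻¹) fun y => by positivity
  have h2 := sum_lagN_div_le_of_odd (h.iterate_sqSeq p) n l hl hln' (z := z ^ 2 ^ p) (by simp [hz])
  rw [hk, hN]
  simp only [block_two_pow_mul h, ← map_pow]
  refine h1.trans ?_
  rw [mul_comm]
  exact mul_le_mul_of_nonneg_right h2 (zero_le_one.trans (one_le_lebesgueRoots p))


/-! ### Lagrange polynomials of the roots of unity -/

theorem mem_unitySet_iff {N : ℕ} (hN : 0 < N) {x : ℂ} : x ∈ unitySet N ↔ x ^ N = 1 := by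
  refine ⟨pow_of_mem_unitySet hN, fun hx => ?_⟩
  have h := (Complex.isPrimitiveRoot_exp N hN.ne')
  have : unitySet N = Polynomial.nthRootsFinset N (1 : ℂ) :=
    eq_of_card_of_pow_eq hN (card_unitySet N hN) h.card_nthRootsFinset
      (fun x hx => pow_of_mem_unitySet hN hx) fun x hx => (Polynomial.mem_nthRootsFinset hN _).1 hx
  rw [this]
  exact (Polynomial.mem_nthRootsFinset hN _).2 hx

theorem nodal_unitySet {N : ℕ} (hN : 0 < N) :
    Lagrange.nodal (unitySet N) id = (Polynomial.X ^ N - 1 : Polynomial ℂ) := by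
  have h := (Complex.isPrimitiveRoot_exp N hN.ne')
  have : unitySet N = Polynomial.nthRootsFinset N (1 : ℂ) := by
    ext x; rw [mem_unitySet_iff hN, Polynomial.mem_nthRootsFinset hN]
  rw [Polynomial.X_pow_sub_one_eq_prod hN h, ← this]
  rfl

theorem prod_unitySet_sub {N : ℕ} (hN : 0 < N) (z : ℂ) :
    ∏ t ∈ unitySet N, (z - t) = z ^ N - 1 := by
  have := congrArg (Polynomial.eval z) (nodal_unitySet hN)
  simpa [Lagrange.eval_nodal] using this

theorem norm_of_mem_unitySet {N : ℕ} (hN : 0 < N) {b : ℂ} (hb : b ∈ unitySet N) : ‖b‖ = 1 :=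
  Complex.norm_eq_one_of_pow_eq_one (pow_of_mem_unitySet hN hb) hN.ne'

theorem conj_mem_unitySet {N : ℕ} (hN : 0 < N) {b : ℂ} (hb : b ∈ unitySet N) :
    conj b ∈ unitySet N := by
  rw [mem_unitySet_iff hN] at hb ⊢
  rw [← map_pow, hb, map_one]

theorem lagSet_unitySet_mul {N : ℕ} (hN : 0 < N) {s : ℂ} (hs : s ∈ unitySet N) (z : ℂ) :
    lagSet (unitySet N) s z * (N * ‖z - s‖) = ‖z ^ N - 1‖ := by
  have h1 := Lagrange.eval_nodal_derivative_eval_node_eq (v := id) hs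
  rw [nodal_unitySet hN, Lagrange.eval_nodal] at h1
  have h2 : ∏ t ∈ (unitySet N).erase s, ‖s - t‖ = N := by
    have := congrArg norm h1
    simp only [id, norm_prod] at this
    rw [← this]
    simp [norm_of_mem_unitySet hN hs, Polynomial.derivative_X_pow]
  have hN' : (N : ℝ) ≠ 0 := by exact_mod_cast hN.ne'
  rw [lagSet, prod_div_distrib, h2, ← prod_unitySet_sub hN, norm_prod,
    ← prod_erase_mul _ _ hs]
  field_simp

/-! ### Projection onto the real line -/

theorem eq_or_eq_conj {a b : ℂ} (ha : ‖a‖ = 1) (hb : ‖b‖ = 1) (h : a.re = b.re) :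
    a = b ∨ a = conj b := by
  have h1 : a.re * a.re + a.im * a.im = 1 := by
    rw [← Complex.normSq_apply, ← Complex.sq_norm, ha, one_pow]
  have h2 : b.re * b.re + b.im * b.im = 1 := by
    rw [← Complex.normSq_apply, ← Complex.sq_norm, hb, one_pow]
  have h3 : (a.im - b.im) * (a.im + b.im) = 0 := by rw [h] at h1; linarith
  rcases mul_eq_zero.1 h3 with h4 | h4
  · exact .inl (Complex.ext h (sub_eq_zero.1 h4))
  · exact .inr (Complex.ext h (by simpa using eq_neg_of_add_eq_zero_left h4))

theorem two_mul_abs_re_sub {z b : ℂ} (hz : ‖z‖ = 1) (hb : ‖b‖ = 1) :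
    2 * |z.re - b.re| = ‖z - b‖ * ‖z - conj b‖ := by
  have h1 : (z - b) * (z - conj b) = z * ((2 * (z.re - b.re) : ℝ) : ℂ) := by
    have hz' : z * conj z = 1 := by rw [Complex.mul_conj, ← Complex.sq_norm, hz]; simp
    have hb' : b * conj b = 1 := by rw [Complex.mul_conj, ← Complex.sq_norm, hb]; simp
    have h2 := Complex.add_conj z
    have h3 := Complex.add_conj b
    push_cast at h2 h3 ⊢
    linear_combination hb' - hz' - z * h3 + z * h2
  rw [← norm_mul, h1, norm_mul, hz, one_mul, Complex.norm_real, Real.norm_eq_abs, abs_mul, abs_two]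

theorem norm_conj_sub (z b : ℂ) : ‖conj z - b‖ = ‖z - conj b‖ := by
  rw [← RCLike.norm_conj (z - conj b)]; simp

theorem norm_sub_one_mul_norm_add_one {z : ℂ} (hz : ‖z‖ = 1) :
    ‖z - 1‖ * ‖z + 1‖ = ‖z - conj z‖ := by
  have hz' : z * conj z = 1 := by rw [Complex.mul_conj, ← Complex.sq_norm, hz]; simp
  have : (z - 1) * (z + 1) = z * (z - conj z) := by linear_combination hz'
  rw [← norm_mul, this, norm_mul, hz, one_mul]

section Fibers

variable {N : ℕ}

theorem filter_re_eq (hN : 0 < N) {b : ℂ} (hb : b ∈ unitySet N) :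
    (unitySet N).filter (fun a => a.re = b.re) = {b, conj b} := by
  ext a
  simp only [mem_filter, mem_insert, mem_singleton]
  constructor
  · rintro ⟨ha, h⟩
    exact eq_or_eq_conj (norm_of_mem_unitySet hN ha) (norm_of_mem_unitySet hN hb) h
  · rintro (rfl | rfl)
    · exact ⟨hb, rfl⟩
    · exact ⟨conj_mem_unitySet hN hb, by simp⟩

theorem conj_eq_self_of_norm {b : ℂ} (hb : ‖b‖ = 1) (h : conj b = b) : b = 1 ∨ b = -1 := by
  have h1 : b * b = 1 := by
    have : b * conj b = 1 := by rw [Complex.mul_conj, ← Complex.sq_norm, hb]; simp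
    rwa [h] at this
  exact mul_self_eq_one_iff.1 h1

/-- The fibres of `Re` are pairs `{b, conj b}`, except at `1` and `-1`, where they are single
points; the factors `f 1` and `f (-1)` make up for these. -/
theorem prod_image_re_sq (hN : 0 < N) (hN2 : Even N) (f : ℝ → ℝ) :
    (∏ s ∈ (unitySet N).image Complex.re, f s) ^ 2 =
      f 1 * f (-1) * ∏ b ∈ unitySet N, f b.re := by
  have m1 : (1 : ℝ) ∈ (unitySet N).image Complex.re :=
    mem_image.2 ⟨1, (mem_unitySet_iff hN).2 (one_pow N), rfl⟩
  have m2 : (-1 : ℝ) ∈ (unitySet N).image Complex.re :=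
    mem_image.2 ⟨-1, (mem_unitySet_iff hN).2 hN2.neg_one_pow, by simp⟩
  have h1 : f 1 = ∏ s ∈ (unitySet N).image Complex.re, if s = 1 then f 1 else 1 := by
    rw [prod_ite_eq' _ (1 : ℝ) fun _ => f 1, if_pos m1]
  have h2 : f (-1) = ∏ s ∈ (unitySet N).image Complex.re, if s = -1 then f (-1) else 1 := by
    rw [prod_ite_eq' _ (-1 : ℝ) fun _ => f (-1), if_pos m2]
  rw [prod_comp f Complex.re, h1, h2, ← prod_mul_distrib, ← prod_mul_distrib, ← prod_pow]
  refine prod_congr rfl fun s hs => ?_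
  obtain ⟨b, hb, rfl⟩ := mem_image.1 hs
  rw [filter_re_eq hN hb]
  have hb1 := norm_of_mem_unitySet hN hb
  by_cases hc : conj b = b
  · rw [hc, pair_eq_singleton, card_singleton, pow_one, sq]
    rcases conj_eq_self_of_norm hb1 hc with rfl | rfl
    · norm_num
    · norm_num
  · have hne1 : b.re ≠ 1 := fun h => hc (by
      rcases eq_or_eq_conj hb1 (norm_one (α := ℂ)) (by simpa using h) with rfl | rfl <;> simp)
    have hne2 : b.re ≠ -1 := fun h => hc (by
      rcases eq_or_eq_conj hb1 (b := -1) (by simp) (by simpa using h) with rfl | rfl <;> simp)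
    rw [card_pair (Ne.symm hc), if_neg hne1, if_neg hne2, one_mul, one_mul]

theorem card_image_re (hN : 0 < N) (hN2 : Even N) :
    2 * ((unitySet N).image Complex.re).card = N + 2 := by
  -- Constant factors `2` turn the product formula into a count, read off from the exponents.
  have h := prod_image_re_sq hN hN2 fun _ => (2 : ℝ)
  rw [prod_const, prod_const, card_unitySet N hN, ← pow_mul] at h
  have h' : (2 : ℝ) ^ (((unitySet N).image Complex.re).card * 2) = 2 ^ (N + 2) := by
    rw [h, pow_add]; ring
  have := pow_right_injective₀ (two_pos (α := ℝ)) (by norm_num) h'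
  omega

theorem prod_image_re_of_notMem (hN : 0 < N) (hN2 : Even N) {z g : ℂ} (hz : ‖z‖ = 1)
    (hg : ‖g‖ = 1) :
    ∏ s ∈ (unitySet N).image Complex.re, |z.re - s| / |g.re - s| =
      ‖z - conj z‖ / ‖g - conj g‖ * (‖z ^ N - 1‖ / ‖g ^ N - 1‖) := by
  have hsq := prod_image_re_sq hN hN2 fun s => |z.re - s| / |g.re - s|
  have hpt : ∀ b : ℂ, ‖b‖ = 1 → |z.re - b.re| / |g.re - b.re| =
      (‖z - b‖ * ‖z - conj b‖) / (‖g - b‖ * ‖g - conj b‖) := by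
    intro b hb
    rw [← two_mul_abs_re_sub hz hb, ← two_mul_abs_re_sub hg hb,
      mul_div_mul_left _ _ (two_ne_zero)]
  have h1 := hpt 1 (by simp)
  have h2 := hpt (-1) (by simp)
  have h3 : ∀ y : ℂ, ∏ b ∈ unitySet N, (‖y - b‖ * ‖y - conj b‖) = ‖y ^ N - 1‖ ^ 2 := by
    intro y
    have hc : ∏ b ∈ unitySet N, ‖y - conj b‖ = ‖y ^ N - 1‖ := by
      simp_rw [← norm_conj_sub]
      rw [← norm_prod, prod_unitySet_sub hN, ← map_pow, norm_conj_sub, map_one]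
    rw [prod_mul_distrib, hc, ← norm_prod, prod_unitySet_sub hN, sq]
  rw [prod_congr rfl fun b hb => hpt b (norm_of_mem_unitySet hN hb),
    prod_div_distrib (s := unitySet N), h3, h3] at hsq
  simp only [Complex.one_re, Complex.neg_re, map_one, map_neg, sub_neg_eq_add] at h1 h2 hsq
  rw [h1, h2] at hsq
  refine (sq_eq_sq₀ (prod_nonneg fun _ _ => by positivity) (by positivity)).1 (hsq.trans ?_)
  rw [← norm_sub_one_mul_norm_add_one hz, ← norm_sub_one_mul_norm_add_one hg]
  rw [mul_pow, div_pow, div_pow, div_mul_div_comm]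
  ring_nf

/-- If `b` is not real, the real Lagrange product times `|z - conj b|` equals `|z - conj z|` times
the complex Lagrange modulus at `b`. Then `|z - conj z| ≤ |z - conj b| + |z - b|`, and the second
summand is turned into the modulus at `conj b`, because `|l_a(z)||z - a|` is the same for all roots
`a`. For `b = ±1` the leftover endpoint factor is at most `1`. -/
theorem prod_image_re_le (hN : 0 < N) (hN2 : Even N) {z b : ℂ} (hz : ‖z‖ = 1)
    (hb : b ∈ unitySet N) (hzb : z ≠ conj b) :
    ∏ s ∈ (unitySet N).image Complex.re, (if s = b.re then 1 else |z.re - s| / |b.re - s|) ≤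
      ∑ a ∈ (unitySet N).filter (fun a => a.re = b.re), lagSet (unitySet N) a z := by
  have hb1 := norm_of_mem_unitySet hN hb
  have hsq := prod_image_re_sq hN hN2 fun s => if s = b.re then 1 else |z.re - s| / |b.re - s|
  set h : ℂ → ℝ := fun a => if a = b ∨ a = conj b then 1 else ‖z - a‖ / ‖b - a‖ with hdef
  set u := ∏ s ∈ (unitySet N).image Complex.re, (if s = b.re then 1 else |z.re - s| / |b.re - s|)
  have hu0 : 0 ≤ u := prod_nonneg fun _ _ => by split_ifs <;> positivity
  have hh0 : 0 ≤ ∏ a ∈ unitySet N, h a :=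
    prod_nonneg fun _ _ => by simp only [hdef]; split_ifs <;> positivity
  have hpt : ∀ a ∈ unitySet N, (if a.re = b.re then 1 else |z.re - a.re| / |b.re - a.re|) =
      h a * h (conj a) := by
    intro a ha
    have ha1 := norm_of_mem_unitySet hN ha
    by_cases hab : a.re = b.re
    · rw [if_pos hab]
      rcases eq_or_eq_conj ha1 hb1 hab with rfl | rfl <;> simp [hdef]
    · have h1 : ¬ (a = b ∨ a = conj b) := by rintro (rfl | rfl) <;> simp at hab
      have h2 : ¬ (conj a = b ∨ conj a = conj b) := by
        rintro (h2 | h2)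
        · rw [← h2] at hab; simp at hab
        · have := congrArg Complex.re h2; simp at this; exact hab this
      simp only [hdef]
      rw [if_neg hab, if_neg h1, if_neg h2, div_mul_div_comm, ← two_mul_abs_re_sub hz ha1,
        ← two_mul_abs_re_sub hb1 ha1, mul_div_mul_left _ _ (two_ne_zero)]
  have hinv : ∏ a ∈ unitySet N, h (conj a) = ∏ a ∈ unitySet N, h a :=
    prod_nbij' (fun a => conj a) (fun a => conj a) (fun a ha => conj_mem_unitySet hN ha)
      (fun a ha => conj_mem_unitySet hN ha) (by simp) (by simp) (by simp)
  rw [prod_congr rfl hpt, prod_mul_distrib, hinv] at hsq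
  have hL : ∀ a, lagSet (unitySet N) a z = ∏ t ∈ unitySet N,
      if t = a then 1 else ‖z - t‖ / ‖a - t‖ := by
    intro a
    rw [lagSet]
    by_cases ha : a ∈ unitySet N
    · rw [← mul_prod_erase _ _ ha, if_pos rfl, one_mul]
      exact prod_congr rfl fun j hj => (if_neg (ne_of_mem_erase hj)).symm
    · rw [erase_eq_of_notMem ha]
      exact prod_congr rfl fun j hj => (if_neg (show ¬ j = a from fun e => ha (e ▸ hj))).symm
  rw [filter_re_eq hN hb]
  by_cases hc : conj b = b
  · rw [hc, pair_eq_singleton, sum_singleton, hL]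
    have hprod : ∏ a ∈ unitySet N, h a = ∏ t ∈ unitySet N,
        if t = b then 1 else ‖z - t‖ / ‖b - t‖ := by
      simp [hdef, hc]
    rw [← hprod]
    refine (sq_le_sq₀ hu0 hh0).1 ?_
    rw [hsq, ← sq]
    have hzr : |z.re| ≤ 1 := (Complex.abs_re_le_norm z).trans hz.le
    have hle : (if (1 : ℝ) = b.re then 1 else |z.re - 1| / |b.re - 1|) *
        (if (-1 : ℝ) = b.re then 1 else |z.re - -1| / |b.re - -1|) ≤ 1 := by
      rw [abs_le] at hzr
      rcases conj_eq_self_of_norm hb1 hc with rfl | rfl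
      · norm_num
        rw [abs_of_nonneg (by linarith)]; linarith
      · norm_num
        rw [abs_of_nonpos (by linarith)]; linarith
    exact mul_le_of_le_one_left (sq_nonneg _) hle
  · rw [sum_pair (Ne.symm hc)]
    have hbb : 0 < ‖b - conj b‖ := norm_pos_iff.2 (sub_ne_zero.2 (Ne.symm hc))
    have hzb' : 0 < ‖z - conj b‖ := norm_pos_iff.2 (sub_ne_zero.2 hzb)
    have hcm := conj_mem_unitySet hN hb
    have hLb : lagSet (unitySet N) b z = (∏ a ∈ unitySet N, h a) * (‖z - conj b‖ / ‖b - conj b‖) := by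
      have : ‖z - conj b‖ / ‖b - conj b‖ = ∏ t ∈ unitySet N,
          if t = conj b then ‖z - conj b‖ / ‖b - conj b‖ else 1 := by
        rw [prod_ite_eq' _ (conj b) fun _ => ‖z - conj b‖ / ‖b - conj b‖, if_pos hcm]
      rw [this, ← prod_mul_distrib, hL]
      refine prod_congr rfl fun t _ => ?_
      by_cases h1 : t = conj b
      · subst h1; simp [hdef, hc]
      · by_cases h2 : t = b
        · subst h2; simp [hdef, h1]
        · simp [hdef, h1, h2]
    have hne1 : ¬ (1 : ℝ) = b.re := fun h => hc (by
      rcases eq_or_eq_conj hb1 (norm_one (α := ℂ)) (by simpa using h.symm) with rfl | rfl <;> simp)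
    have hne2 : ¬ (-1 : ℝ) = b.re := fun h => hc (by
      rcases eq_or_eq_conj hb1 (b := -1) (by simp) (by simpa using h.symm) with rfl | rfl <;> simp)
    have hu : u = ‖z - conj z‖ / ‖b - conj b‖ * ∏ a ∈ unitySet N, h a := by
      refine (sq_eq_sq₀ hu0 (by positivity)).1 ?_
      have e1 := two_mul_abs_re_sub hz (b := 1) (by simp)
      have e2 := two_mul_abs_re_sub hz (b := -1) (by simp)
      have e3 := two_mul_abs_re_sub hb1 (b := 1) (by simp)
      have e4 := two_mul_abs_re_sub hb1 (b := -1) (by simp)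
      simp only [Complex.one_re, Complex.neg_re, map_one, map_neg, sub_neg_eq_add] at e1 e2 e3 e4
      rw [hsq, if_neg hne1, if_neg hne2, sub_neg_eq_add, sub_neg_eq_add,
        ← mul_div_mul_left |z.re - 1| _ (two_ne_zero' ℝ),
        ← mul_div_mul_left |z.re + 1| _ (two_ne_zero' ℝ), e1, e2, e3, e4,
        ← norm_sub_one_mul_norm_add_one hz, ← norm_sub_one_mul_norm_add_one hb1, div_mul_div_comm,
        mul_pow, div_pow]
      ring_nf
    have hmul := (lagSet_unitySet_mul hN hb z).trans (lagSet_unitySet_mul hN hcm z).symm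
    have hN' : (N : ℝ) ≠ 0 := by exact_mod_cast hN.ne'
    have hmul' : lagSet (unitySet N) b z * ‖z - b‖ =
        lagSet (unitySet N) (conj b) z * ‖z - conj b‖ := by
      apply mul_left_cancel₀ hN'
      linarith
    have htri : ‖z - conj z‖ ≤ ‖z - conj b‖ + ‖z - b‖ := by
      have := norm_sub_le_norm_sub_add_norm_sub z (conj b) (conj z)
      rwa [norm_sub_rev (conj b), norm_conj_sub, Complex.conj_conj] at this
    refine le_of_mul_le_mul_right ?_ hzb'
    calc u * ‖z - conj b‖ = ‖z - conj z‖ * lagSet (unitySet N) b z := by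
          rw [hu, hLb]; field_simp
      _ ≤ (‖z - conj b‖ + ‖z - b‖) * lagSet (unitySet N) b z :=
          mul_le_mul_of_nonneg_right htri (lagSet_nonneg _ _ _)
      _ = _ := by rw [add_mul, add_mul, ← hmul']; ring

end Fibers

theorem lagSet_eq_prod {𝕜 : Type*} [NormedField 𝕜] [DecidableEq 𝕜] {S : Finset 𝕜} {s : 𝕜}
    (hs : s ∈ S) (z : 𝕜) :
    lagSet S s z = ∏ t ∈ S, if t = s then 1 else ‖z - t‖ / ‖s - t‖ := by
  have h := lagSet_image S (f := fun t => t) (fun a _ b _ h => h) hs z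
  rwa [image_id'] at h

/-! ### The real parts of a section -/

/-- The set of the real parts of the first `2 ^ (n + 1) + l` elements of `E`. -/
noncomputable def reSection (E : ℕ → ℂ) (n l : ℕ) : Finset ℝ :=
  (range (2 ^ (n + 1) + l)).image fun j => (E j).re

namespace IsLeja

theorem image_range (h : IsLeja E) (p : ℕ) : (range (2 ^ p)).image E = unitySet (2 ^ p) := by
  refine eq_of_card_of_pow_eq (N := 2 ^ p) (a := 1) (by positivity) ?_ ?_ ?_ ?_
  · rw [card_image_of_injective _ h.injective, card_range]
  · exact card_unitySet _ (by positivity)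
  · simp only [mem_image, mem_range, forall_exists_index, and_imp]
    rintro x i hi rfl
    rw [h.pow_eq, Nat.div_eq_of_lt hi, (h.iterate_sqSeq p).zero]
  · exact fun x hx => pow_of_mem_unitySet (by positivity) hx

theorem pow_upper (h : IsLeja E) {n i : ℕ} (hi : i < 2 ^ n) :
    E (2 ^ (n + 1) + i) ^ 2 ^ (n + 1) = -1 := by
  have := h.pow_eq' (n + 1) 1 i (by rw [pow_succ]; omega)
  rwa [one_mul, (h.iterate_sqSeq _).one_eq] at this

/-- Both `2^n`-th powers equal a square root of `-1`, which differs from its conjugate. -/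
theorem upper_ne_conj (h : IsLeja E) {n i j : ℕ} (hi : i < 2 ^ n) (hj : j < 2 ^ n) :
    E (2 ^ (n + 1) + i) ≠ conj (E (2 ^ (n + 1) + j)) := by
  intro heq
  have h1 := h.pow_eq' n 2 i hi
  have h2 := h.pow_eq' n 2 j hj
  rw [show 2 * 2 ^ n = 2 ^ (n + 1) by ring] at h1 h2
  rw [heq, ← map_pow, h2] at h1
  have hF := h.iterate_sqSeq n
  have h3 : (RLeja.sqSeq^[n] E) 2 * conj ((RLeja.sqSeq^[n] E) 2) = 1 := by
    rw [Complex.mul_conj, ← Complex.sq_norm, hF.norm_eq]; simp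
  rw [h1, ← sq, hF.two_sq] at h3
  norm_num at h3

theorem re_upper_injOn (h : IsLeja E) {n l : ℕ} (hl : l ≤ 2 ^ n) :
    Set.InjOn (fun i => (E (2 ^ (n + 1) + i)).re) (range l) := by
  intro i hi j hj hij
  have hi := mem_range.1 hi
  have hj := mem_range.1 hj
  rcases eq_or_eq_conj (h.norm_eq _) (h.norm_eq _) hij with h1 | h1
  · simpa using h.injective h1
  · exact absurd h1 (h.upper_ne_conj (by omega) (by omega))

theorem re_upper_notMem (h : IsLeja E) {n i : ℕ} (hi : i < 2 ^ n) {b : ℂ}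
    (hb : b ∈ unitySet (2 ^ (n + 1))) : b.re ≠ (E (2 ^ (n + 1) + i)).re := by
  have hN : 0 < 2 ^ (n + 1) := by positivity
  have hne : ∀ b ∈ unitySet (2 ^ (n + 1)), E (2 ^ (n + 1) + i) ≠ b := by
    intro b hb heq
    have h1 := h.pow_upper hi
    rw [heq, pow_of_mem_unitySet hN hb] at h1
    norm_num at h1
  intro hre
  rcases eq_or_eq_conj (h.norm_eq _) (norm_of_mem_unitySet hN hb) hre.symm with h1 | h1
  · exact hne _ hb h1
  · exact hne _ (conj_mem_unitySet hN hb) h1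

theorem reSection_eq (h : IsLeja E) {n l : ℕ} (hl : l ≤ 2 ^ n) :
    ∃ hd : Disjoint ((unitySet (2 ^ (n + 1))).image Complex.re)
        ((range l).image fun i => (E (2 ^ (n + 1) + i)).re),
      reSection E n l = ((unitySet (2 ^ (n + 1))).image Complex.re).disjUnion
        ((range l).image fun i => (E (2 ^ (n + 1) + i)).re) hd := by
  refine ⟨?_, ?_⟩
  · rw [disjoint_left]
    intro a ha hb
    obtain ⟨b, hb', rfl⟩ := mem_image.1 ha
    obtain ⟨i, hi, he⟩ := mem_image.1 hb
    exact h.re_upper_notMem (by have := mem_range.1 hi; omega) hb' he.symm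
  · rw [disjUnion_eq_union, ← h.image_range, image_image]
    ext x
    simp only [reSection, mem_union, mem_image, mem_range, Function.comp]
    constructor
    · rintro ⟨j, hj, rfl⟩
      by_cases hj' : j < 2 ^ (n + 1)
      · exact .inl ⟨j, hj', rfl⟩
      · exact .inr ⟨j - 2 ^ (n + 1), by omega, by rw [Nat.add_sub_cancel' (by omega)]⟩
    · rintro (⟨j, hj, rfl⟩ | ⟨j, hj, rfl⟩)
      · exact ⟨j, by omega, rfl⟩
      · exact ⟨2 ^ (n + 1) + j, by omega, rfl⟩

theorem prod_reSection (h : IsLeja E) {n l : ℕ} (hl : l ≤ 2 ^ n) (f : ℝ → ℝ) :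
    ∏ s ∈ reSection E n l, f s = (∏ s ∈ (unitySet (2 ^ (n + 1))).image Complex.re, f s) *
      ∏ i ∈ range l, f (E (2 ^ (n + 1) + i)).re := by
  obtain ⟨hd, he⟩ := h.reSection_eq hl
  rw [he, prod_disjUnion, prod_image (h.re_upper_injOn hl)]

theorem sum_reSection (h : IsLeja E) {n l : ℕ} (hl : l ≤ 2 ^ n) (f : ℝ → ℝ) :
    ∑ s ∈ reSection E n l, f s = (∑ s ∈ (unitySet (2 ^ (n + 1))).image Complex.re, f s) +
      ∑ i ∈ range l, f (E (2 ^ (n + 1) + i)).re := by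
  obtain ⟨hd, he⟩ := h.reSection_eq hl
  rw [he, sum_disjUnion, sum_image (h.re_upper_injOn hl)]

theorem card_reSection (h : IsLeja E) {n l : ℕ} (hl : l ≤ 2 ^ n) :
    (reSection E n l).card = 2 ^ n + 1 + l := by
  obtain ⟨hd, he⟩ := h.reSection_eq hl
  have h1 := card_image_re (N := 2 ^ (n + 1)) (by positivity) ((Nat.even_pow.2 ⟨even_two, by omega⟩))
  rw [he, card_disjUnion, card_image_of_injOn (h.re_upper_injOn hl), card_range]
  rw [pow_succ] at h1 ⊢
  omega

end IsLeja

/-! ### Comparison of real and weighted complex Lagrange polynomials -/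

/-- A Lagrange polynomial of a section of `E`, weighted by the nodal polynomial of the conjugates
of the nodes of index at least `2 ^ (n + 1)`. -/
noncomputable def weightedLag (E : ℕ → ℂ) (n l j : ℕ) (z : ℂ) : ℝ :=
  lagN E (2 ^ (n + 1) + l) j z *
    (‖block E (2 ^ (n + 1)) l (conj z)‖ / ‖block E (2 ^ (n + 1)) l (conj (E j))‖)

theorem weightedLag_nonneg (E : ℕ → ℂ) (n l j : ℕ) (z : ℂ) : 0 ≤ weightedLag E n l j z :=
  mul_nonneg (lagN_nonneg _ _ _ _) (by positivity)

theorem norm_block (E : ℕ → ℂ) (o l : ℕ) (z : ℂ) :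
    ‖block E o l z‖ = ∏ i ∈ range l, ‖z - E (o + i)‖ := by
  rw [block, norm_prod]

theorem norm_block_conj (E : ℕ → ℂ) (o l : ℕ) (z : ℂ) :
    ‖block E o l (conj z)‖ = ∏ i ∈ range l, ‖z - conj (E (o + i))‖ := by
  rw [norm_block]
  exact prod_congr rfl fun i _ => norm_conj_sub _ _

theorem weightedLag_of_lt (h : IsLeja E) {n l j : ℕ} (hj : j < 2 ^ (n + 1)) (z : ℂ) :
    weightedLag E n l j z = lagSet (unitySet (2 ^ (n + 1))) (E j) z *
      ((‖block E (2 ^ (n + 1)) l z‖ * ‖block E (2 ^ (n + 1)) l (conj z)‖) /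
        (‖block E (2 ^ (n + 1)) l (E j)‖ * ‖block E (2 ^ (n + 1)) l (conj (E j))‖)) := by
  have : lagN E (2 ^ (n + 1) + l) j z = lagN E (2 ^ (n + 1)) j z *
      (‖block E (2 ^ (n + 1)) l z‖ / ‖block E (2 ^ (n + 1)) l (E j)‖) := by
    rw [lagN, prod_range_add, lagN, norm_block, norm_block, ← prod_div_distrib]
    congr 1
    exact prod_congr rfl fun i _ => if_neg (by omega)
  rw [weightedLag, this, lagN_eq_lagSet h.injective hj, h.image_range, mul_assoc, div_mul_div_comm]

theorem prod_upper_of_mem (h : IsLeja E) {n l : ℕ} {z b : ℂ} (hz : ‖z‖ = 1) (hb : ‖b‖ = 1) :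
    ∏ i ∈ range l, (|z.re - (E (2 ^ (n + 1) + i)).re| / |b.re - (E (2 ^ (n + 1) + i)).re|) =
      (‖block E (2 ^ (n + 1)) l z‖ * ‖block E (2 ^ (n + 1)) l (conj z)‖) /
        (‖block E (2 ^ (n + 1)) l b‖ * ‖block E (2 ^ (n + 1)) l (conj b)‖) := by
  rw [norm_block_conj, norm_block_conj, norm_block, norm_block, ← prod_mul_distrib,
    ← prod_mul_distrib, ← prod_div_distrib]
  refine prod_congr rfl fun i _ => ?_
  rw [← two_mul_abs_re_sub hz (h.norm_eq _), ← two_mul_abs_re_sub hb (h.norm_eq _),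
    mul_div_mul_left _ _ (two_ne_zero)]

/-- The weight takes the same value at `b` and `conj b`, so it factors out of each fibre of `Re`,
where `prod_image_re_le` applies. -/
theorem sum_lower_le (h : IsLeja E) {n l : ℕ} (hl : l ≤ 2 ^ n) {z : ℂ} (hz : ‖z‖ = 1)
    (hzn : z.re ∉ reSection E n l) :
    ∑ s ∈ (unitySet (2 ^ (n + 1))).image Complex.re, lagSet (reSection E n l) s z.re ≤
      ∑ j ∈ range (2 ^ (n + 1)), weightedLag E n l j z := by
  have hN : 0 < 2 ^ (n + 1) := by positivity
  have hN2 : Even (2 ^ (n + 1)) := Nat.even_pow.2 ⟨even_two, by omega⟩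
  set K : ℂ → ℝ := fun b => (‖block E (2 ^ (n + 1)) l z‖ * ‖block E (2 ^ (n + 1)) l (conj z)‖) /
        (‖block E (2 ^ (n + 1)) l b‖ * ‖block E (2 ^ (n + 1)) l (conj b)‖) with hK
  have hK0 : ∀ b, 0 ≤ K b := fun b => by positivity
  rw [sum_congr rfl fun j hj => weightedLag_of_lt h (mem_range.1 hj) z,
    ← sum_image (f := fun b => lagSet (unitySet (2 ^ (n + 1))) b z * K b) h.injective.injOn,
    h.image_range, ← sum_fiberwise_of_maps_to (g := Complex.re)
      (t := (unitySet (2 ^ (n + 1))).image Complex.re) fun b hb => mem_image_of_mem _ hb]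
  refine sum_le_sum fun s hs => ?_
  obtain ⟨b, hb, rfl⟩ := mem_image.1 hs
  have hb1 := norm_of_mem_unitySet hN hb
  have hbD : b.re ∈ reSection E n l := by
    obtain ⟨hd, he⟩ := h.reSection_eq hl
    rw [he, mem_disjUnion]; exact .inl hs
  have hzb : z ≠ conj b := by
    rintro rfl
    exact hzn (by simpa using hbD)
  have hsum : ∑ a ∈ (unitySet (2 ^ (n + 1))).filter (fun a => a.re = b.re),
      lagSet (unitySet (2 ^ (n + 1))) a z * K a = (∑ a ∈ (unitySet (2 ^ (n + 1))).filter
        (fun a => a.re = b.re), lagSet (unitySet (2 ^ (n + 1))) a z) * K b := by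
    rw [sum_mul]
    refine sum_congr rfl fun a ha => ?_
    rw [filter_re_eq hN hb, mem_insert, mem_singleton] at ha
    rcases ha with rfl | rfl
    · rfl
    · congr 1
      simp only [hK, Complex.conj_conj]
      rw [mul_comm ‖block E (2 ^ (n + 1)) l (conj b)‖]
  rw [hsum, lagSet_eq_prod hbD, h.prod_reSection hl]
  have hup : ∏ i ∈ range l, (if (E (2 ^ (n + 1) + i)).re = b.re then 1 else
      ‖z.re - (E (2 ^ (n + 1) + i)).re‖ / ‖b.re - (E (2 ^ (n + 1) + i)).re‖) = K b := by
    rw [hK]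
    simp only
    rw [← prod_upper_of_mem h hz hb1]
    refine prod_congr rfl fun i hi => ?_
    have hi := mem_range.1 hi
    rw [if_neg (h.re_upper_notMem (by omega) hb).symm]
    rfl
  rw [hup]
  exact mul_le_mul_of_nonneg_right (prod_image_re_le hN hN2 hz hb hzb) (hK0 b)

/-- The conjugate of this node `g` is not a node of the section, so its role is taken over by the
point `conj z`: the triangle inequality is as in `prod_image_re_le`, and the symmetry used is that
`weightedLag` at `z` times `|z - g|` equals `weightedLag` at `conj z` times `|z - conj g|`. -/
theorem lagSet_upper_le (h : IsLeja E) {n l i : ℕ} (hl : l ≤ 2 ^ n) (hi : i < l) {z : ℂ}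
    (hz : ‖z‖ = 1) (hzn : z.re ∉ reSection E n l) :
    lagSet (reSection E n l) (E (2 ^ (n + 1) + i)).re z.re ≤
      weightedLag E n l (2 ^ (n + 1) + i) z + weightedLag E n l (2 ^ (n + 1) + i) (conj z) := by
  have hN : 0 < 2 ^ (n + 1) := by positivity
  have hN2 : Even (2 ^ (n + 1)) := Nat.even_pow.2 ⟨even_two, by omega⟩
  set N := 2 ^ (n + 1) with hNdef
  set g := E (N + i) with hg
  have hg1 : ‖g‖ = 1 := h.norm_eq _
  have hgD : g.re ∈ reSection E n l :=
    mem_image.2 ⟨N + i, mem_range.2 (by omega), rfl⟩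
  have hgg : 0 < ‖g - conj g‖ :=
    norm_pos_iff.2 (sub_ne_zero.2 (h.upper_ne_conj (by omega) (by omega)))
  have hzg : 0 < ‖z - conj g‖ := by
    refine norm_pos_iff.2 (sub_ne_zero.2 ?_)
    rintro rfl
    exact hzn (by simpa using hgD)
  have hgN : ‖g ^ N - 1‖ = 2 := by
    rw [hg, h.pow_upper (by omega)]; norm_num
  set u : ℂ → ℝ := fun y => ∏ i' ∈ range l, if i' = i then 1 else ‖y - E (N + i')‖ / ‖g - E (N + i')‖
    with hu
  have hlagN : ∀ y, lagN E (N + l) (N + i) y = ‖y ^ N - 1‖ / 2 * u y := by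
    intro y
    have hlow : ∀ y, ∏ j ∈ range N, ‖y - E j‖ = ‖y ^ N - 1‖ := by
      intro y
      rw [← norm_prod, ← prod_unitySet_sub hN, ← h.image_range, prod_image h.injective.injOn]
    rw [lagN, prod_range_add]
    congr 1
    · rw [← hgN, ← hlow, ← hlow, ← prod_div_distrib]
      exact prod_congr rfl fun j hj => if_neg (by have := mem_range.1 hj; omega)
    · refine prod_congr rfl fun j _ => ?_
      simp only [Nat.add_left_cancel_iff]
      rfl
  have hublock : ∀ y, u y * ‖y - g‖ = ‖block E N l y‖ /
      ∏ i' ∈ range l, if i' = i then 1 else ‖g - E (N + i')‖ := by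
    intro y
    have : ‖y - g‖ = ∏ i' ∈ range l, if i' = i then ‖y - g‖ else 1 := by
      rw [prod_ite_eq' (range l) i fun _ => ‖y - g‖, if_pos (mem_range.2 hi)]
    rw [this, hu, ← prod_mul_distrib, norm_block, ← prod_div_distrib]
    refine prod_congr rfl fun i' _ => ?_
    split_ifs with hii
    · rw [hii]; simp [hg]
    · simp
  have hsymm : weightedLag E n l (N + i) z * ‖z - g‖ =
      weightedLag E n l (N + i) (conj z) * ‖z - conj g‖ := by
    have e1 := hublock z
    have e2 := hublock (conj z)
    rw [norm_conj_sub] at e2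
    rw [weightedLag, weightedLag, hlagN, hlagN, Complex.conj_conj, ← map_pow]
    have e3 : ‖conj (z ^ N) - 1‖ = ‖z ^ N - 1‖ := by rw [norm_conj_sub, map_one]
    rw [e3]
    have e4 := congrArg (fun t => ‖z ^ N - 1‖ / 2 *
      (‖block E N l (conj z)‖ / ‖block E N l (conj g)‖) * t) e1
    have e5 := congrArg (fun t => ‖z ^ N - 1‖ / 2 *
      (‖block E N l z‖ / ‖block E N l (conj g)‖) * t) e2
    linear_combination e4 - e5
  have hval : lagSet (reSection E n l) g.re z.re * ‖z - conj g‖ =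
      ‖z - conj z‖ * weightedLag E n l (N + i) z := by
    rw [lagSet_eq_prod hgD, h.prod_reSection hl, ← hNdef]
    have e1 : ∏ s ∈ (unitySet N).image Complex.re,
        (if s = g.re then 1 else ‖z.re - s‖ / ‖g.re - s‖) =
        ‖z - conj z‖ / ‖g - conj g‖ * (‖z ^ N - 1‖ / ‖g ^ N - 1‖) := by
      rw [← prod_image_re_of_notMem hN hN2 hz hg1]
      refine prod_congr rfl fun s hs => ?_
      obtain ⟨b, hb, rfl⟩ := mem_image.1 hs
      rw [if_neg (h.re_upper_notMem (by omega) hb)]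
      rfl
    have e2 : (∏ i' ∈ range l, if (E (N + i')).re = g.re then 1 else
        ‖z.re - (E (N + i')).re‖ / ‖g.re - (E (N + i')).re‖) * (‖z - conj g‖ / ‖g - conj g‖) =
        u z * (‖block E N l (conj z)‖ / ‖block E N l (conj g)‖) := by
      have : ‖z - conj g‖ / ‖g - conj g‖ =
          ∏ i' ∈ range l, if i' = i then ‖z - conj g‖ / ‖g - conj g‖ else 1 := by
        rw [prod_ite_eq' (range l) i fun _ => ‖z - conj g‖ / ‖g - conj g‖,
          if_pos (mem_range.2 hi)]
      rw [this, norm_block_conj, norm_block_conj, ← prod_div_distrib, hu, ← prod_mul_distrib,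
        ← prod_mul_distrib]
      refine prod_congr rfl fun i' hi' => ?_
      by_cases hii : i' = i
      · subst hii; simp [hg]
      · have hne : (E (N + i')).re ≠ g.re := fun he =>
          hii (h.re_upper_injOn hl hi' (mem_range.2 hi) he)
        rw [if_neg hne, if_neg hii, if_neg hii, mul_one, div_mul_div_comm,
          ← two_mul_abs_re_sub hz (h.norm_eq _), ← two_mul_abs_re_sub hg1 (h.norm_eq _),
          mul_div_mul_left _ _ (two_ne_zero)]
        rfl
    rw [e1, weightedLag, hlagN, hgN, mul_assoc (‖z ^ N - 1‖ / 2), ← e2]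
    field_simp
  have htri : ‖z - conj z‖ ≤ ‖z - conj g‖ + ‖z - g‖ := by
    have := norm_sub_le_norm_sub_add_norm_sub z (conj g) (conj z)
    rwa [norm_sub_rev (conj g), norm_conj_sub, Complex.conj_conj] at this
  refine le_of_mul_le_mul_right ?_ hzg
  calc _ = ‖z - conj z‖ * weightedLag E n l (N + i) z := hval
    _ ≤ (‖z - conj g‖ + ‖z - g‖) * weightedLag E n l (N + i) z :=
        mul_le_mul_of_nonneg_right htri (weightedLag_nonneg _ _ _ _ _)
    _ = _ := by rw [add_mul, add_mul, ← hsymm]; ring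

theorem sum_lagSet_reSection_le_weightedLag (h : IsLeja E) {n l : ℕ} (hl : l ≤ 2 ^ n) {z : ℂ}
    (hz : ‖z‖ = 1) (hzn : z.re ∉ reSection E n l) :
    ∑ s ∈ reSection E n l, lagSet (reSection E n l) s z.re ≤
      ∑ j ∈ range (2 ^ (n + 1) + l), weightedLag E n l j z +
        ∑ j ∈ range (2 ^ (n + 1) + l), weightedLag E n l j (conj z) := by
  rw [h.sum_reSection hl, sum_range_add, sum_range_add]
  have h1 := sum_lower_le h hl hz hzn
  have h2 := sum_le_sum fun i (hi : i ∈ range l) => lagSet_upper_le h hl (mem_range.1 hi) hz hzn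
  rw [sum_add_distrib] at h2
  have h3 : 0 ≤ ∑ j ∈ range (2 ^ (n + 1)), weightedLag E n l j (conj z) :=
    sum_nonneg fun _ _ => weightedLag_nonneg _ _ _ _ _
  linarith

theorem sum_weightedLag_le (h : IsLeja E) (n p l : ℕ) (hl : Odd l) (hln : 2 ^ p * l < 2 ^ (p + n))
    {z : ℂ} (hz : ‖z‖ = 1) :
    ∑ j ∈ range (2 ^ (p + n + 1) + 2 ^ p * l), weightedLag E (p + n) (2 ^ p * l) j z ≤
      3 * Real.sqrt 5 * 2 ^ (n + sigmaOne l) * lebesgueRoots p := by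
  have h1 := sum_lagN_div_le h n p l hl hln hz
  have h2 : ‖block E (2 ^ (p + n + 1)) (2 ^ p * l) (conj z)‖ ≤ 2 ^ sigmaOne l := by
    rw [← sigmaOne_two_pow_mul p l]
    have := norm_block_le h (p + n + 1) 1 (2 ^ p * l) (by rw [pow_succ]; omega)
      (z := conj z) (by simp [hz])
    rwa [one_mul] at this
  have h3 : ∑ j ∈ range (2 ^ (p + n + 1) + 2 ^ p * l), weightedLag E (p + n) (2 ^ p * l) j z =
      ‖block E (2 ^ (p + n + 1)) (2 ^ p * l) (conj z)‖ *
      ∑ j ∈ range (2 ^ (p + n + 1) + 2 ^ p * l), lagN E (2 ^ (p + n + 1) + 2 ^ p * l) j z *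
      ‖block E (2 ^ (p + n + 1)) (2 ^ p * l) (conj (E j))‖⁻¹ := by
    rw [mul_sum]
    refine sum_congr rfl fun j _ => ?_
    rw [weightedLag, div_eq_mul_inv]; ring
  rw [h3]
  refine (mul_le_mul h2 h1 (sum_nonneg fun _ _ => mul_nonneg (lagN_nonneg _ _ _ _)
    (by positivity)) (by positivity)).trans (le_of_eq ?_)
  rw [pow_add]; ring

theorem sum_lagSet_reSection_le (h : IsLeja E) (n p l : ℕ) (hl : Odd l)
    (hln : 2 ^ p * l < 2 ^ (p + n)) {x : ℝ} (hx : x ∈ Interval) :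
    ∑ s ∈ reSection E (p + n) (2 ^ p * l), lagSet (reSection E (p + n) (2 ^ p * l)) s x ≤
      6 * Real.sqrt 5 * 2 ^ (n + sigmaOne l) * lebesgueRoots p := by
  by_cases hxn : x ∈ reSection E (p + n) (2 ^ p * l)
  · rw [sum_lagSet_of_mem _ hxn]
    have h1 := one_le_lebesgueRoots p
    have h2 : 1 ≤ Real.sqrt 5 := Real.one_le_sqrt.2 (by norm_num)
    have h3 : (1 : ℝ) ≤ 2 ^ (n + sigmaOne l) := one_le_pow₀ one_le_two
    have h4 : 1 ≤ 6 * Real.sqrt 5 := by linarith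
    exact one_le_mul_of_one_le_of_one_le (one_le_mul_of_one_le_of_one_le h4 h3) h1
  · obtain ⟨hx1, hx2⟩ := hx
    set z : ℂ := ⟨x, Real.sqrt (1 - x ^ 2)⟩ with hzdef
    have hz : ‖z‖ = 1 := by
      have : ‖z‖ ^ 2 = 1 := by
        rw [Complex.sq_norm, Complex.normSq_apply, hzdef]
        simp only
        rw [Real.mul_self_sqrt (by nlinarith)]; ring
      exact (pow_eq_one_iff_of_nonneg (norm_nonneg _) two_ne_zero).1 this
    have h1 := sum_lagSet_reSection_le_weightedLag h hln.le hz hxn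
    have h2 := sum_weightedLag_le h n p l hl hln hz
    have h3 := sum_weightedLag_le h n p l hl hln (z := conj z) (by simp [hz])
    linarith

/-! ### Sections of the projected sequence -/

theorem image_projection {R : ℕ → Interval} {E : ℕ → Disc} (hR : IsProjectionOf R E) :
    Function.Injective R ∧ ∀ m, 1 ≤ m → ∃ k, (range k).image (fun i => (R i : ℝ)) =
      (range m).image fun j => (E j : ℂ).re := by
  obtain ⟨J, hJ0, hJ, hRJ⟩ := hR
  have hne : ∀ k, ∀ i ≤ k, (R (k + 1) : ℝ) ≠ R i := by
    intro k i hi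
    rw [hRJ (k + 1)]
    exact (hJ k).1.2 i hi
  have hmono : StrictMono J := strictMono_nat_of_lt_succ fun k => (hJ k).1.1
  refine ⟨?_, fun m hm => ?_⟩
  · have hlt : ∀ i j, i < j → R j ≠ R i := by
      intro i j hij heq
      obtain ⟨k, rfl⟩ : ∃ k, j = k + 1 := ⟨j - 1, by omega⟩
      exact hne k i (by omega) (congrArg Subtype.val heq)
    intro i j hij
    rcases lt_trichotomy i j with h | h | h
    · exact absurd hij.symm (hlt i j h)
    · exact h
    · exact absurd hij (hlt j i h)
  -- The induction also tracks that `m` lies in `(J k, J (k + 1)]`; a new real part enters exactly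
  -- when `m` reaches `J (k + 1)`.
  · suffices ∃ k, J k < m ∧ m ≤ J (k + 1) ∧ (range (k + 1)).image (fun i => (R i : ℝ)) =
        (range m).image fun j => (E j : ℂ).re by
      obtain ⟨k, -, -, hk⟩ := this
      exact ⟨k + 1, hk⟩
    induction m, hm using Nat.le_induction with
    | base =>
      refine ⟨0, by omega, ?_, by simp [hRJ 0, hJ0]⟩
      have := (hJ 0).1.1
      omega
    | succ m hm ih =>
      obtain ⟨k, hkm, hmk, hk⟩ := ih
      rcases hmk.lt_or_eq with hlt | heq
      · refine ⟨k, by omega, hlt, ?_⟩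
        rw [range_add_one (n := m), image_insert, ← hk]
        refine (insert_eq_of_mem ?_).symm
        by_contra hmem
        refine absurd ((hJ k).2 ⟨hkm, fun i hi heq => hmem ?_⟩) (not_le.2 hlt)
        exact mem_image.2 ⟨i, mem_range.2 (by omega), heq.symm⟩
      · refine ⟨k + 1, by omega, by have := (hJ (k + 1)).1.1; omega, ?_⟩
        rw [range_add_one (n := m), range_add_one (n := k + 1), image_insert, image_insert, hk,
          hRJ (k + 1), heq]

theorem isLeja_of_isLejaFromOne {E : ℕ → Disc} (h : IsLejaFromOne E) :
    IsLeja fun j => (E j : ℂ) where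
  zero := h.1
  norm_le j := mem_closedBall_zero_iff.1 (E j).2
  le k z hz := by
    rcases Nat.eq_zero_or_pos k with rfl | hk
    · simp
    · exact h.2 k hk ⟨z, mem_closedBall_zero_iff.2 hz⟩

theorem lebesgueSection_le {R : ℕ → Interval} (hR : IsRLeja R) (n p l : ℕ) (hl : Odd l)
    (hln : 2 ^ p * l < 2 ^ (p + n)) :
    lebesgueSection R (2 ^ (p + n) + 1 + 2 ^ p * l) ≤
      6 * Real.sqrt 5 * 2 ^ (n + sigmaOne l) * lebesgueRoots p := by
  obtain ⟨E, hE, hRE⟩ := hR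
  have h := isLeja_of_isLejaFromOne hE
  obtain ⟨hinj, hk⟩ := image_projection hRE
  obtain ⟨k, hk⟩ := hk (2 ^ (p + n + 1) + 2 ^ p * l) (by have := Nat.one_le_two_pow (n := p + n + 1); omega)
  have hcard := congrArg Finset.card hk
  have hinj' : Function.Injective fun i => (R i : ℝ) := Subtype.val_injective.comp hinj
  -- The length of the section of `R` is recovered by counting its points.
  rw [card_image_of_injective _ hinj', card_range] at hcard
  have hcard2 := h.card_reSection (n := p + n) hln.le
  rw [reSection, ← hcard] at hcard2
  subst hcard2
  have : Nonempty Interval := ⟨⟨0, by norm_num, by norm_num⟩⟩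
  have hv : Function.Injective (initialSection R (2 ^ (p + n) + 1 + 2 ^ p * l)) :=
    fun i j hij => Fin.ext (hinj hij)
  obtain ⟨x, hx⟩ := (isGreatest_lebesgueConstant _ hv).1
  rw [lebesgueSection, ← hx, lebesgueFunction_eq _ hv x (S := reSection (fun j => (E j : ℂ)) (p + n) (2 ^ p * l))]
  · exact sum_lagSet_reSection_le h n p l hl hln x.2
  · rw [reSection, ← hk]
    ext y
    simp only [mem_image, mem_univ, true_and, mem_range, initialSection]
    exact ⟨fun ⟨i, hi⟩ => ⟨i, i.2, hi⟩, fun ⟨i, hi, hy⟩ => ⟨⟨i, hi⟩, hy⟩⟩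


/-! ### The Lebesgue constants of the roots of unity -/

/-- The moduli are linearized by coefficients of modulus at most `1`, chosen at `z` and then frozen;
the maximum principle applies to the resulting polynomial. -/
theorem sum_lagSet_le_of_circle {S : Finset ℂ} {B : ℝ}
    (hB : ∀ y : ℂ, ‖y‖ = 1 → ∑ s ∈ S, lagSet S s y ≤ B) {z : ℂ} (hz : ‖z‖ ≤ 1) :
    ∑ s ∈ S, lagSet S s z ≤ B := by
  set c : ℂ → ℂ → ℂ := fun s y => ∏ t ∈ S.erase s, (y - t) / (s - t) with hc
  have hnc : ∀ s y, ‖c s y‖ = lagSet S s y := fun s y => by simp [hc, lagSet]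
  set u : ℂ → ℂ := fun s => if c s z = 0 then 0 else (‖c s z‖ : ℂ) / c s z with hu
  have hu1 : ∀ s, ‖u s‖ ≤ 1 := by
    intro s
    by_cases h : c s z = 0 <;> simp [hu, h]
  have huc : ∀ s, u s * c s z = (‖c s z‖ : ℂ) := by
    intro s
    by_cases h : c s z = 0 <;> simp [hu, h]
  have hd : Differentiable ℂ fun y => ∑ s ∈ S, u s * c s y := by
    simp only [hc, div_eq_mul_inv]
    fun_prop
  have hmax := Complex.norm_le_of_forall_mem_frontier_norm_le (U := Metric.ball (0 : ℂ) 1)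
    (C := B) Metric.isBounded_ball hd.diffContOnCl (fun y hy => by
      rw [frontier_ball _ one_ne_zero, mem_sphere_zero_iff_norm] at hy
      refine (norm_sum_le _ _).trans (le_trans (sum_le_sum fun s _ => ?_) (hB y hy))
      rw [norm_mul, hnc]
      exact mul_le_of_le_one_left (lagSet_nonneg _ _ _) (hu1 s)) (z := z) (by
      rw [closure_ball _ one_ne_zero]; simpa using hz)
  simp only [huc, ← Complex.ofReal_sum, hnc] at hmax
  rw [Complex.norm_real, Real.norm_of_nonneg (sum_nonneg fun _ _ => lagSet_nonneg _ _ _)] at hmax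
  exact hmax

/-- `E` serves only to enumerate the roots of unity, so that `quad_two_mul` can be iterated down to
one node. -/
theorem sum_lagSet_unitySet_sq {E : ℕ → ℂ} (h : IsLeja E) (p : ℕ) {z : ℂ} (hz : ‖z‖ = 1) :
    ∑ s ∈ unitySet (2 ^ p), lagSet (unitySet (2 ^ p)) s z ^ 2 = 1 := by
  have hq : ∀ {E : ℕ → ℂ}, IsLeja E → ∀ {z : ℂ}, ‖z‖ = 1 → quad E (2 ^ p) z = 1 := by
    induction p with
    | zero => intro E _ z _; simp [quad, lagN]
    | succ p ih =>
      intro E h z hz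
      rw [pow_succ', quad_two_mul h _ hz]
      exact ih h.sqSeq (by simp [hz])
  rw [← hq h hz, quad, ← h.image_range, sum_image h.injective.injOn]
  exact sum_congr rfl fun i hi => by rw [lagN_eq_lagSet h.injective (mem_range.1 hi)]

theorem lebesgueRoots_zero : lebesgueRoots 0 = 1 := by
  obtain ⟨z, -, hz⟩ := exists_sum_lagSet_unitySet_eq 0
  have : unitySet (2 ^ 0) = {1} := by
    ext x
    rw [mem_unitySet_iff (by positivity), mem_singleton]
    simp
  rw [← hz, this]
  simp [lagSet]

theorem lebesgueRoots_one {E : ℕ → ℂ} (h : IsLeja E) : lebesgueRoots 1 = Real.sqrt 2 := by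
  have hU : unitySet (2 ^ 1) = {1, -1} := by
    ext x
    rw [mem_unitySet_iff (by positivity), mem_insert, mem_singleton, pow_one, sq, mul_self_eq_one_iff]
  have hne : (1 : ℂ) ≠ -1 := by norm_num
  refine le_antisymm ?_ ?_
  · obtain ⟨z, hz, hzL⟩ := exists_sum_lagSet_unitySet_eq 1
    rw [← hzL]
    refine sum_lagSet_le_of_circle (fun y hy => ?_) hz
    have h2 := sum_lagSet_unitySet_sq h 1 hy
    rw [hU, sum_pair hne] at h2 ⊢
    refine Real.le_sqrt_of_sq_le ?_
    nlinarith [sq_nonneg (lagSet {1, -1} 1 y - lagSet {1, -1} (-1) y)]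
  · have h1 := sum_lagSet_unitySet_le 1 (z := Complex.I) (by simp)
    refine le_trans (le_of_eq ?_) h1
    have e1 : ({1, -1} : Finset ℂ).erase 1 = {-1} := by
      ext x; simp only [mem_erase, mem_insert, mem_singleton]; grind
    have e2 : ({1, -1} : Finset ℂ).erase (-1) = {1} := by
      ext x; simp only [mem_erase, mem_insert, mem_singleton]; grind
    have n1 : ‖Complex.I + 1‖ = Real.sqrt 2 := by
      rw [Complex.norm_def, Complex.normSq_apply]; norm_num
    have n2 : ‖Complex.I - 1‖ = Real.sqrt 2 := by
      rw [Complex.norm_def, Complex.normSq_apply]; norm_num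
    have n3 : ‖(1 : ℂ) + 1‖ = 2 := by norm_num
    have n4 : ‖(-1 : ℂ) - 1‖ = 2 := by norm_num
    rw [hU, sum_pair hne, lagSet, lagSet, e1, e2, prod_singleton, prod_singleton, sub_neg_eq_add,
      sub_neg_eq_add, n1, n2, n3, n4]
    ring

/-! ### Logarithmic bound through the integral of the cosecant -/

/-- A primitive of `1 / sin` on `(0, π)`. -/
noncomputable def cscPrimitive (y : ℝ) : ℝ := Real.log (Real.sin (y / 2)) - Real.log (Real.cos (y / 2))

theorem hasDerivAt_cscPrimitive {y : ℝ} (h0 : 0 < y) (hpi : y < Real.pi) :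
    HasDerivAt cscPrimitive (1 / Real.sin y) y := by
  have hs : 0 < Real.sin (y / 2) := Real.sin_pos_of_pos_of_lt_pi (by linarith) (by linarith)
  have hc : 0 < Real.cos (y / 2) := Real.cos_pos_of_mem_Ioo ⟨by linarith, by linarith⟩
  have hd : HasDerivAt (fun y : ℝ => y / 2) (1 / 2) y := (hasDerivAt_id y).div_const 2
  have h1 := hd.sin.log hs.ne'
  have h2 := hd.cos.log hc.ne'
  have h3 := h1.sub h2
  refine h3.congr_deriv ?_
  have hsin : Real.sin y = 2 * Real.sin (y / 2) * Real.cos (y / 2) := by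
    rw [← Real.sin_two_mul]; ring_nf
  have hsq := Real.sin_sq_add_cos_sq (y / 2)
  rw [hsin]
  field_simp
  linear_combination hsq

/-- Midpoint inequality for the convex function `1 / sin`, obtained by differentiating in the
half-width. -/
theorem two_mul_div_sin_le {x h : ℝ} (hh : 0 ≤ h) (hx : h < x) (hx' : x + h < Real.pi) :
    2 * h / Real.sin x ≤ cscPrimitive (x + h) - cscPrimitive (x - h) := by
  have hsx : 0 < Real.sin x := Real.sin_pos_of_pos_of_lt_pi (by linarith) (by linarith)
  set ψ : ℝ → ℝ := fun s => cscPrimitive (x + s) - cscPrimitive (x - s) - 2 * s / Real.sin x with hψ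
  have hder : ∀ s ∈ Set.Icc 0 h, HasDerivAt ψ
      (1 / Real.sin (x + s) + 1 / Real.sin (x - s) - 2 / Real.sin x) s := by
    rintro s ⟨hs0, hs1⟩
    have h1 := (hasDerivAt_cscPrimitive (y := x + s) (by linarith) (by linarith)).comp s
      ((hasDerivAt_id s).const_add x)
    have h2 := (hasDerivAt_cscPrimitive (y := x - s) (by linarith) (by linarith)).comp s
      ((hasDerivAt_id s).const_sub x)
    have h3 := ((hasDerivAt_id s).const_mul 2).div_const (Real.sin x)
    refine ((h1.sub h2).sub h3).congr_deriv ?_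
    ring
  have hmono : MonotoneOn ψ (Set.Icc 0 h) := by
    refine monotoneOn_of_deriv_nonneg (convex_Icc 0 h)
      (fun s hs => (hder s hs).continuousAt.continuousWithinAt)
      (fun s hs => (hder s (interior_subset hs)).differentiableAt.differentiableWithinAt)
      fun s hs => ?_
    have hs := interior_subset hs
    rw [(hder s hs).deriv]
    obtain ⟨hs0, hs1⟩ := hs
    have hA : 0 < Real.sin (x + s) := Real.sin_pos_of_pos_of_lt_pi (by linarith) (by linarith)
    have hB : 0 < Real.sin (x - s) := Real.sin_pos_of_pos_of_lt_pi (by linarith) (by linarith)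
    have hAB : Real.sin (x + s) + Real.sin (x - s) ≤ 2 * Real.sin x := by
      rw [Real.sin_add, Real.sin_sub]
      have := Real.cos_le_one s
      nlinarith
    have h4 : 4 / (Real.sin (x + s) + Real.sin (x - s)) ≤
        1 / Real.sin (x + s) + 1 / Real.sin (x - s) := by
      rw [div_add_div _ _ hA.ne' hB.ne', div_le_div_iff₀ (by positivity) (by positivity)]
      nlinarith [sq_nonneg (Real.sin (x + s) - Real.sin (x - s))]
    have h5 : 2 / Real.sin x ≤ 4 / (Real.sin (x + s) + Real.sin (x - s)) := by
      rw [div_le_div_iff₀ hsx (by positivity)]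
      linarith
    linarith
  have := hmono (Set.left_mem_Icc.2 hh) (Set.right_mem_Icc.2 hh) hh
  simp only [hψ] at this
  simp at this
  linarith

theorem log_half_le_cscPrimitive {y : ℝ} (h0 : 0 < y) (hpi : y < Real.pi) :
    Real.log (y / 2) ≤ cscPrimitive y := by
  have hs : 0 < Real.sin (y / 2) := Real.sin_pos_of_pos_of_lt_pi (by linarith) (by linarith)
  have hc : 0 < Real.cos (y / 2) := Real.cos_pos_of_mem_Ioo ⟨by linarith, by linarith⟩
  rw [cscPrimitive, ← Real.log_div hs.ne' hc.ne', ← Real.tan_eq_sin_div_cos]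
  exact Real.log_le_log (by linarith) (Real.le_tan (by linarith) (by linarith))

theorem cscPrimitive_pi_sub (y : ℝ) : cscPrimitive (Real.pi - y) = -cscPrimitive y := by
  rw [cscPrimitive, cscPrimitive, show (Real.pi - y) / 2 = Real.pi / 2 - y / 2 by ring,
    Real.sin_pi_div_two_sub, Real.cos_pi_div_two_sub]
  ring

theorem sum_inv_sin_le (K : ℕ) {t : ℝ} (ht0 : 0 < t) (ht : t < Real.pi / (K + 2)) :
    ∑ m ∈ range K, 1 / ((K + 2) * Real.sin (t + Real.pi * (m + 1) / (K + 2))) ≤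
      2 / Real.pi * Real.log (K + 2) := by
  have hpi := Real.pi_pos
  have hN : (0 : ℝ) < K + 2 := by positivity
  set h : ℝ := Real.pi / (2 * (K + 2)) with hh
  have hNh : 2 * (K + 2) * h = Real.pi := by rw [hh]; field_simp
  have hh0 : 0 < h := by positivity
  have ht2 : t < 2 * h := by
    have : Real.pi / (K + 2) = 2 * h := by rw [hh]; field_simp
    linarith
  have hterm : ∀ m ∈ range K, 1 / ((K + 2) * Real.sin (t + Real.pi * (m + 1) / (K + 2))) ≤
      1 / Real.pi * (cscPrimitive (t + h + 2 * h * (m + 1 : ℕ)) - cscPrimitive (t + h + 2 * h * m)) := by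
    intro m hm
    have hm : (m : ℝ) + 1 ≤ K := by exact_mod_cast mem_range.1 hm
    have hx : t + Real.pi * (m + 1) / (K + 2) = t + 2 * h * (m + 1) := by
      rw [hh]; field_simp
    have hm0 : (0 : ℝ) ≤ m := Nat.cast_nonneg m
    have hmh := mul_le_mul_of_nonneg_left hm hh0.le
    have hmh0 := mul_nonneg hh0.le hm0
    have key := two_mul_div_sin_le (x := t + 2 * h * (m + 1)) hh0.le (by nlinarith) (by nlinarith)
    have hsin : 0 < Real.sin (t + 2 * h * (m + 1)) :=
      Real.sin_pos_of_pos_of_lt_pi (by nlinarith) (by nlinarith)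
    rw [hx]
    have e1 : t + 2 * h * (m + 1) + h = t + h + 2 * h * (m + 1 : ℕ) := by push_cast; ring
    have e2 : t + 2 * h * (m + 1) - h = t + h + 2 * h * m := by ring
    rw [e1, e2] at key
    refine le_trans (le_of_eq ?_) (mul_le_mul_of_nonneg_left key (by positivity))
    rw [← hNh]
    field_simp
  refine (sum_le_sum hterm).trans ?_
  rw [← mul_sum, sum_range_sub fun m : ℕ => cscPrimitive (t + h + 2 * h * m)]
  have e3 : t + h + 2 * h * (K : ℕ) = Real.pi - (3 * h - t) := by rw [← hNh]; ring
  rw [e3, cscPrimitive_pi_sub, Nat.cast_zero, mul_zero, add_zero]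
  have hKh : 0 ≤ h * K := by positivity
  have l1 := log_half_le_cscPrimitive (y := 3 * h - t) (by linarith) (by nlinarith)
  have l2 := log_half_le_cscPrimitive (y := t + h) (by linarith) (by nlinarith)
  have l3 : -(2 * Real.log (K + 2)) ≤ Real.log ((3 * h - t) / 2) + Real.log ((t + h) / 2) := by
    rw [← Real.log_mul (by linarith) (by linarith)]
    have : -(2 * Real.log ((K : ℝ) + 2)) = Real.log ((((K : ℝ) + 2) ^ 2)⁻¹) := by
      rw [Real.log_inv, Real.log_pow]; norm_num
    rw [this]
    refine Real.log_le_log (by positivity) ?_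
    -- As `0 < t < 2h`, `(3h - t)(t + h) = 3h² + t(2h - t) ≥ 3h²`.
    have h3 : 3 * h ^ 2 / 4 ≤ (3 * h - t) / 2 * ((t + h) / 2) := by nlinarith
    refine le_trans ?_ h3
    rw [inv_le_iff_one_le_mul₀ (by positivity)]
    have : 3 * h ^ 2 / 4 * ((K : ℝ) + 2) ^ 2 = 3 * Real.pi ^ 2 / 16 := by rw [← hNh]; ring
    rw [this]
    nlinarith [Real.pi_gt_three]
  have l4 : -cscPrimitive (3 * h - t) - cscPrimitive (t + h) ≤ 2 * Real.log (K + 2) := by linarith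
  calc _ ≤ 1 / Real.pi * (2 * Real.log (K + 2)) := mul_le_mul_of_nonneg_left l4 (by positivity)
    _ = _ := by ring

theorem exists_exp_eq {w : ℂ} (hw : ‖w‖ = 1) (hw1 : w ≠ 1) :
    ∃ φ : ℝ, 0 < φ ∧ φ < 2 * Real.pi ∧ w = Complex.exp (Complex.I * φ) := by
  have h0 : w = Complex.exp (Complex.I * w.arg) := by
    have := Complex.norm_mul_exp_arg_mul_I w
    rw [hw, Complex.ofReal_one, one_mul, mul_comm] at this
    exact this.symm
  have hne : w.arg ≠ 0 := by
    intro h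
    rw [h] at h0
    simp at h0
    exact hw1 h0
  rcases lt_or_gt_of_ne hne with h1 | h1
  · refine ⟨w.arg + 2 * Real.pi, by linarith [Complex.neg_pi_lt_arg w, Real.pi_pos], by linarith, ?_⟩
    push_cast
    rw [mul_add, Complex.exp_add, ← h0, show Complex.I * (2 * Real.pi) = 2 * Real.pi * Complex.I by ring,
      Complex.exp_two_pi_mul_I, mul_one]
  · exact ⟨w.arg, h1, by linarith [Complex.arg_le_pi w, Real.pi_pos], h0⟩

theorem sum_lagSet_unitySet_le_log {E : ℕ → ℂ} (h : IsLeja E) (p K : ℕ) (hK : 2 ^ p = K + 2) {z : ℂ}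
    (hz : ‖z‖ = 1) :
    ∑ s ∈ unitySet (2 ^ p), lagSet (unitySet (2 ^ p)) s z ≤
      Real.sqrt 2 + 2 / Real.pi * Real.log (K + 2) := by
  have hN : 0 < 2 ^ p := by positivity
  have hpi := Real.pi_pos
  by_cases hz1 : z ^ 2 ^ p = 1
  · rw [sum_lagSet_of_mem _ ((mem_unitySet_iff hN).2 hz1)]
    have h1 : 1 ≤ Real.sqrt 2 := Real.one_le_sqrt.2 one_le_two
    have h2 : 0 ≤ Real.log ((K : ℝ) + 2) := Real.log_nonneg (by linarith [K.cast_nonneg (α := ℝ)])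
    have : 0 ≤ 2 / Real.pi * Real.log (K + 2) := by positivity
    linarith
  obtain ⟨φ, hφ0, hφ1, hφ⟩ := exists_exp_eq (w := z ^ 2 ^ p) (by simp [hz]) hz1
  have hsq := sum_lagSet_unitySet_sq h p hz
  rw [hK] at *
  have hNr : (0 : ℝ) < K + 2 := by positivity
  have hNc : ((K : ℂ) + 2) ≠ 0 := by exact_mod_cast hNr.ne'
  set t : ℝ := φ / (2 * (K + 2)) with ht
  have ht0 : 0 < t := by positivity
  have ht1 : t < Real.pi / (K + 2) := by
    rw [ht, div_lt_div_iff₀ (by positivity) hNr]; nlinarith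
  -- The roots of unity are listed in order of angle, going round from `z`; `θ m` is half the angle
  -- between `z` and `ν m`. The first and the last one are the neighbours of `z`, and the `K` others
  -- get the sine bound.
  set θ : ℕ → ℝ := fun m => t + Real.pi * m / (K + 2) with hθ
  set ν : ℕ → ℂ := fun m => z * Complex.exp (Complex.I * ((-(2 * θ m) : ℝ) : ℂ)) with hν
  have hνpow : ∀ m, ν m ^ (K + 2) = 1 := by
    intro m
    rw [hν, mul_pow, hφ, ← Complex.exp_nat_mul, ← Complex.exp_add, Complex.exp_eq_one_iff]
    refine ⟨-m, ?_⟩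
    rw [hθ, ht]
    push_cast
    field_simp
    ring
  have hinj : Set.InjOn ν (range (K + 2)) := by
    have hprim := (Complex.isPrimitiveRoot_exp (K + 2) (by omega)).inv
    have hform : ∀ m, ν m = ν 0 * (Complex.exp (2 * Real.pi * Complex.I / (K + 2 : ℕ)))⁻¹ ^ m := by
      intro m
      simp only [hν, hθ]
      rw [← Complex.exp_neg, ← Complex.exp_nat_mul, mul_assoc, ← Complex.exp_add]
      congr 2
      push_cast
      field_simp
      ring
    intro a ha b hb hab
    have hν0 : ν 0 ≠ 0 := fun h0 => by
      have := hνpow 0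
      rw [h0] at this; simp at this
    rw [hform a, hform b] at hab
    exact hprim.pow_inj (mem_range.1 ha) (mem_range.1 hb) (mul_left_cancel₀ hν0 hab)
  have himg : (range (K + 2)).image ν = unitySet (K + 2) := by
    refine eq_of_card_of_pow_eq hN (a := 1) ?_ (card_unitySet _ hN) ?_
      fun x hx => pow_of_mem_unitySet hN hx
    · rw [card_image_of_injOn hinj, card_range]
    · intro x hx
      obtain ⟨m, -, rfl⟩ := mem_image.1 hx
      exact hνpow m
  have hbound : ∀ m ∈ range (K + 2), lagSet (unitySet (K + 2)) (ν m) z ≤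
      1 / ((K + 2) * Real.sin (θ m)) := by
    intro m hm
    have hmem : ν m ∈ unitySet (K + 2) := (mem_unitySet_iff hN).2 (hνpow m)
    have h1 := lagSet_unitySet_mul hN hmem z
    have hm' : (m : ℝ) + 1 ≤ K + 2 := by exact_mod_cast mem_range.1 hm
    have hsin : 0 < Real.sin (θ m) := by
      refine Real.sin_pos_of_pos_of_lt_pi (by simp only [hθ]; positivity) ?_
      have : Real.pi * m / (K + 2) + Real.pi / (K + 2) ≤ Real.pi := by
        rw [← add_div, div_le_iff₀ hNr]; nlinarith
      simp only [hθ]; linarith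
    have h2 : ‖z - ν m‖ = 2 * Real.sin (θ m) := by
      rw [hν, show z - z * Complex.exp (Complex.I * ((-(2 * θ m) : ℝ) : ℂ)) =
        -(z * (Complex.exp (Complex.I * ((-(2 * θ m) : ℝ) : ℂ)) - 1)) by ring, norm_neg, norm_mul, hz,
        one_mul, Complex.norm_exp_I_mul_ofReal_sub_one, Real.norm_eq_abs,
        show -(2 * θ m) / 2 = -θ m by ring, Real.sin_neg, mul_neg, abs_neg, abs_of_pos (by linarith)]
    have h3 : ‖z ^ (K + 2) - 1‖ ≤ 2 := by
      refine (norm_sub_le _ _).trans ?_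
      simp [hz]; norm_num
    rw [le_div_iff₀ (by positivity)]
    rw [h2] at h1
    push_cast at h1
    linarith
  rw [← himg, sum_image hinj, himg] at hsq ⊢
  rw [sum_range_succ, sum_range_succ'] at hsq ⊢
  have hmid : ∑ m ∈ range K, lagSet (unitySet (K + 2)) (ν (m + 1)) z ≤
      2 / Real.pi * Real.log (K + 2) := by
    refine le_trans (sum_le_sum fun m hm => hbound (m + 1) ?_) ?_
    · have := mem_range.1 hm; exact mem_range.2 (by omega)
    · have := sum_inv_sin_le K ht0 ht1
      simpa [hθ] using this
  have hend : lagSet (unitySet (K + 2)) (ν 0) z + lagSet (unitySet (K + 2)) (ν (K + 1)) z ≤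
      Real.sqrt 2 := by
    refine Real.le_sqrt_of_sq_le ?_
    have h0 : 0 ≤ ∑ m ∈ range K, lagSet (unitySet (K + 2)) (ν (m + 1)) z ^ 2 :=
      sum_nonneg fun _ _ => sq_nonneg _
    nlinarith [sq_nonneg (lagSet (unitySet (K + 2)) (ν 0) z - lagSet (unitySet (K + 2)) (ν (K + 1)) z)]
  linarith

theorem sqrt_two_le : Real.sqrt 2 ≤ 2 / Real.pi * (9 / 4) := by
  have h1 : Real.sqrt 2 ≤ 1.4143 := by
    rw [Real.sqrt_le_left (by norm_num)]; norm_num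
  have h2 := Real.pi_lt_d4
  have hpi := Real.pi_pos
  rw [div_mul_eq_mul_div, le_div_iff₀ hpi]
  have := Real.sqrt_nonneg 2
  nlinarith

theorem lebesgueRoots_le {E : ℕ → ℂ} (h : IsLeja E) (p : ℕ) :
    lebesgueRoots p ≤ 2 / Real.pi * (Real.log ((2 : ℝ) ^ p) + 9 / 4) := by
  rcases Nat.eq_zero_or_pos p with rfl | hp
  · rw [lebesgueRoots_zero]
    have := sqrt_two_le
    have h1 : 1 ≤ Real.sqrt 2 := Real.one_le_sqrt.2 one_le_two
    simp
    linarith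
  obtain ⟨K, hK⟩ : ∃ K, 2 ^ p = K + 2 :=
    ⟨2 ^ p - 2, by have := Nat.pow_le_pow_right (n := 2) (by norm_num) hp; omega⟩
  obtain ⟨z, hz, hzL⟩ := exists_sum_lagSet_unitySet_eq p
  have h1 := sum_lagSet_le_of_circle (fun y hy => sum_lagSet_unitySet_le_log h p K hK hy) hz
  have h2 : (2 : ℝ) ^ p = K + 2 := by exact_mod_cast hK
  rw [hzL] at h1
  rw [h2, mul_add]
  linarith [sqrt_two_le]

end RLeja

/-! ### The main theorem -/

theorem theorem3p2 (R : ℕ → RLeja.Interval) (hR : RLeja.IsRLeja R) :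
    -- the bound, for `2^n < k - 1 < 2^(n+1)` and `l = k - (2^n + 1)`
    (∀ n k l : ℕ, 2 ^ n + 1 < k → k < 2 ^ (n + 1) + 1 → k = 2 ^ n + 1 + l →
      RLeja.lebesgueSection R k ≤
        6 * Real.sqrt 5 *
          (2 : ℝ) ^ ((n : ℤ) + (RLeja.sigmaOne l : ℤ) - (RLeja.twoVal l : ℤ)) *
          RLeja.lebesgueRoots (RLeja.twoVal l)) ∧
    -- the size of the Lebesgue constants of the roots of unity
    (RLeja.lebesgueRoots 0 = 1 ∧ RLeja.lebesgueRoots 1 = Real.sqrt 2 ∧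
      ∀ p : ℕ, 2 ≤ p →
        RLeja.lebesgueRoots p ≤ 2 / Real.pi * (Real.log ((2 : ℝ) ^ p) + 9 / 4)) ∧
    -- for fixed `m`, the bound is logarithmic for `k = 2^n + 1 + 2^(n-m) k'`
    (∀ n m k' : ℕ, 1 ≤ m → m ≤ n → 1 ≤ k' → k' < 2 ^ m →
      RLeja.lebesgueSection R (2 ^ n + 1 + 2 ^ (n - m) * k') ≤
        6 * Real.sqrt 5 * (2 : ℝ) ^ (2 * m) *
          (2 / Real.pi * (Real.log ((2 : ℝ) ^ n) + 9 / 4))) := by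
  obtain ⟨E, hE, -⟩ := id hR
  have h := RLeja.isLeja_of_isLejaFromOne hE
  refine ⟨fun n k l hk hk' hkl => ?_, ⟨RLeja.lebesgueRoots_zero, RLeja.lebesgueRoots_one h,
    fun p _ => RLeja.lebesgueRoots_le h p⟩, fun n m k' hm hmn hk' hk'm => ?_⟩
  · have hl0 : l ≠ 0 := by omega
    have hln : l < 2 ^ n := by rw [pow_succ] at hk'; omega
    obtain ⟨p, l', hodd, rfl⟩ := Nat.exists_eq_two_pow_mul_odd hl0
    have hval : RLeja.twoVal (2 ^ p * l') = p := by
      have hl'0 : l' ≠ 0 := hodd.pos.ne'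
      rw [RLeja.twoVal, padicValNat.mul (by positivity) hl'0, padicValNat.prime_pow,
        padicValNat.eq_zero_of_not_dvd hodd.not_two_dvd_nat, add_zero]
    have hpn : p ≤ n := by
      by_contra hlt
      have h1 := Nat.pow_le_pow_right (n := 2) (by norm_num) (not_le.1 hlt).le
      have h2 := Nat.le_mul_of_pos_right (2 ^ p) hodd.pos
      omega
    obtain ⟨q, rfl⟩ := Nat.exists_eq_add_of_le hpn
    rw [hkl, hval, RLeja.sigmaOne_two_pow_mul]
    convert RLeja.lebesgueSection_le hR q p l' hodd hln using 3
    rw [← zpow_natCast]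
    congr 1
    push_cast
    ring
  · obtain ⟨v, l', hodd, rfl⟩ := Nat.exists_eq_two_pow_mul_odd (by omega : k' ≠ 0)
    have hvm : v ≤ m := by
      by_contra hlt
      have h1 := Nat.pow_le_pow_right (n := 2) (by norm_num) (not_le.1 hlt).le
      have h2 := Nat.le_mul_of_pos_right (2 ^ v) hodd.pos
      omega
    obtain ⟨r, rfl⟩ := Nat.exists_eq_add_of_le hmn
    obtain ⟨w, rfl⟩ := Nat.exists_eq_add_of_le hvm
    have hl'w : l' < 2 ^ w := by
      rw [pow_add] at hk'm
      exact lt_of_mul_lt_mul_left hk'm (by positivity)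
    -- With `k' = 2^v l'` and `m = v + w`, the exponent of the general bound is `w + σ₁(l') ≤ 2w ≤
    -- 2m`. The valuation `r + v` may be `0` or `1`, which is why `lebesgueRoots_le` covers every
    -- `p`.
    have hσ := RLeja.sigmaOne_le w l' hl'w
    have hkey := RLeja.lebesgueSection_le hR w (r + v) l' hodd (by
      rw [pow_add 2 (r + v)]; exact Nat.mul_lt_mul_of_pos_left hl'w (by positivity))
    rw [show r + v + w = v + w + r by ring, pow_add 2 r v, mul_assoc] at hkey
    rw [Nat.add_sub_cancel_left]
    refine hkey.trans ?_
    have h1 : (2 : ℝ) ^ (w + RLeja.sigmaOne l') ≤ 2 ^ (2 * (v + w)) :=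
      pow_le_pow_right₀ one_le_two (by omega)
    have h2 : RLeja.lebesgueRoots (r + v) ≤
        2 / Real.pi * (Real.log ((2 : ℝ) ^ (v + w + r)) + 9 / 4) := by
      refine (RLeja.lebesgueRoots_le h (r + v)).trans ?_
      have : Real.log ((2 : ℝ) ^ (r + v)) ≤ Real.log ((2 : ℝ) ^ (v + w + r)) :=
        Real.log_le_log (by positivity) (pow_le_pow_right₀ one_le_two (by omega))
      have hpi := Real.pi_pos
      gcongr
    exact mul_le_mul (mul_le_mul_of_nonneg_left h1 (by positivity)) h2
      (zero_le_one.trans (RLeja.one_le_lebesgueRoots _)) (by positivity)
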